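/- Let $\mathbf{H}^3$ be hyperbolic three-space (constant curvature $-1$). For $v>0$ let $A(v)$ be the area of a round sphere in $\mathbf{H}^3$ enclosing volume $v$. For $v,w>0$ let $A(v,w)$ be the total area of the standard double bubble in $\mathbf{H}^3$ that encloses and separates regions of volumes $v$ and $w$: the double bubble, unique up to isometries, that consists of two spherical caps (the outer caps) and a piece of a sphere, hyposphere (equidistant surface), horosphere or geodesic plane (the inner cap), the three meeting along a common circle at angles of $120^\circ$. Define the Hutchings function of $\mathbf{H}^3$ by $$F(v,w)=2A\!\left(\tfrac v2\right)+A(w)+A(v+w)-2A(v,w),$$ and let $\lambda=\frac{e^2}{4}-1$. Then for all real $w\ge 150$ and $v\ge\lambda w$, the partial derivative of $F$ with respect to $v$ exists at $(v,w)$ and $$\frac{\partial F}{\partial v}(v,w)>0 .$$ -/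

import Mathlib

open MeasureTheory
open scoped ENNReal

noncomputable section

namespace HypBubble

/-! Hyperbolic three-space is the upper half-space `{(ζ, t) : ζ ∈ ℂ, t > 0}` with the Riemannian
metric `(|dζ|² + dt²) / t²` of constant curvature `-1`. -/

/-- The underlying set of the upper half-space model of `H³`. -/
def upperHalfSpace : Set (ℂ × ℝ) := {p | 0 < p.2}

/-- The Riemannian metric `(|dζ|² + dt²) / t²` at `p`, applied to two tangent vectors. -/
def hypMetric (p u v : ℂ × ℝ) : ℝ :=
  ((u.1 * (starRingEnd ℂ) v.1).re + u.2 * v.2) / p.2 ^ 2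

/-- The angle at `p` between two nonzero tangent vectors. -/
def hypAngle (p u v : ℂ × ℝ) : ℝ :=
  Real.arccos (hypMetric p u v / (√(hypMetric p u u) * √(hypMetric p v v)))

/-- Hyperbolic volume: the Riemannian volume element of the model is `dζ dt / t³`. -/
def hypVolume (E : Set (ℂ × ℝ)) : ℝ≥0∞ :=
  ∫⁻ p in E ∩ upperHalfSpace, ENNReal.ofReal (1 / p.2 ^ 3)

/-- The first partial derivative of a parametrized surface `X`. -/
def partialFst (X : ℝ → ℝ → ℂ × ℝ) (s θ : ℝ) : ℂ × ℝ := deriv (fun x => X x θ) s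

/-- The second partial derivative of a parametrized surface `X`. -/
def partialSnd (X : ℝ → ℝ → ℂ × ℝ) (s θ : ℝ) : ℂ × ℝ := deriv (fun y => X s y) θ

/-- Hyperbolic area of the surface parametrized by `X` on `D`: the integral of `√(EG - F²)`, where
`E, F, G` are the coefficients of the first fundamental form in the hyperbolic metric. -/
def surfaceArea (X : ℝ → ℝ → ℂ × ℝ) (D : Set (ℝ × ℝ)) : ℝ :=
  ∫ q in D,
    √(hypMetric (X q.1 q.2) (partialFst X q.1 q.2) (partialFst X q.1 q.2)
        * hypMetric (X q.1 q.2) (partialSnd X q.1 q.2) (partialSnd X q.1 q.2)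
      - hypMetric (X q.1 q.2) (partialFst X q.1 q.2) (partialSnd X q.1 q.2) ^ 2)

/-! The Euclidean spheres centred on the line `ζ = 0`, and the planes orthogonal to it, cut out in
the upper half-space the spheres, hyposphere (equidistant) surfaces, horospheres and geodesic planes
that are symmetric about the geodesic `ζ = 0` and cross it orthogonally. Such a surface is described
by a pole `(0, h)` and the signed Euclidean curvature `κ` of its generating curve at that pole: for
`κ ≠ 0` it is the sphere with centre `(0, h + 1 / κ)` and radius `1 / |κ|`, for `κ = 0` the plane
`t = h`. It is a hyperbolic sphere exactly when `κ ≠ 0` and both poles `h` and `h + 2 / κ` are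
positive. -/

/-- Distance to the axis, along the generating curve: the plane curve of constant signed curvature
`κ` with unit Euclidean speed that leaves the axis orthogonally, so that its tangent at the
parameter `s` is `(cos (κ s), sin (κ s))`. -/
def profileRadius (κ s : ℝ) : ℝ := ∫ u in (0 : ℝ)..s, Real.cos (κ * u)

/-- Height along the same generating curve, when it leaves the axis at height `h`. -/
def profileHeight (h κ s : ℝ) : ℝ := h + ∫ u in (0 : ℝ)..s, Real.sin (κ * u)

/-- The surface of revolution generated by that curve; `s` is the parameter of the generating curve
and `θ` the angle of rotation about the geodesic `ζ = 0`. -/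
def cap (h κ s θ : ℝ) : ℂ × ℝ :=
  ((profileRadius κ s : ℂ) * Complex.exp (θ * Complex.I), profileHeight h κ s)

/-- The hyperbolic area of the cap around the pole `(0, h)` whose generating arc has Euclidean
length `ℓ`. -/
def capArea (h κ ℓ : ℝ) : ℝ :=
  surfaceArea (cap h κ) (Set.Icc 0 ℓ ×ˢ Set.Icc 0 (2 * Real.pi))

/-- The equation `sideFun h κ p = 0` describes the whole surface with pole `(0, h)` and curvature
`κ`; the sign of `sideFun h κ p` tells on which side of it the point `p` lies. -/
def sideFun (h κ : ℝ) (p : ℂ × ℝ) : ℝ :=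
  κ * (‖p.1‖ ^ 2 + (p.2 - h) ^ 2) - 2 * (p.2 - h)

/-- The side of the surface that contains the points of the axis just above the pole `(0, h)`; the
open ball bounded by the surface if `κ > 0`. -/
def aboveSide (h κ : ℝ) : Set (ℂ × ℝ) := {p | 0 < p.2 ∧ sideFun h κ p < 0}

/-- The side of the surface that contains the points of the axis just below the pole `(0, h)`; the
open ball bounded by the surface if `κ < 0` and `h + 2 / κ > 0`. -/
def belowSide (h κ : ℝ) : Set (ℂ × ℝ) := {p | 0 < p.2 ∧ 0 < sideFun h κ p}

/-- `sphereArea v` is the area `A(v)` of a round sphere enclosing volume `v`. The sphere is placed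
with its centre on the geodesic `ζ = 0`; `h` is its lower pole, and the generating half circle has
length `π / κ`. -/
def sphereArea (v : ℝ) : ℝ :=
  Classical.epsilon fun a : ℝ => ∃ h κ : ℝ, 0 < h ∧ 0 < κ ∧
    hypVolume (aboveSide h κ) = ENNReal.ofReal v ∧ a = capArea h κ (Real.pi / κ)

/-- A standard double bubble, moved by an isometry so that its axis of symmetry is the geodesic
`ζ = 0`: three caps that meet along a common circle at angles of `120°`. Cap `1` is the upper outer
cap, cap `2` the lower outer cap, and cap `0` the inner cap that separates the two regions. -/
structure StandardDoubleBubble where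
  /-- heights of the poles of the three caps -/
  h : Fin 3 → ℝ
  /-- signed curvatures of the three generating arcs -/
  κ : Fin 3 → ℝ
  /-- lengths of the three generating arcs, from the pole to the common circle -/
  ℓ : Fin 3 → ℝ
  h_pos : ∀ i, 0 < h i
  ℓ_pos : ∀ i, 0 < ℓ i
  /-- each generating arc is less than a half circle from pole to pole -/
  arc_lt : ∀ i, |κ i| * ℓ i < Real.pi
  /-- the inner cap crosses the axis between the two outer caps -/
  lower_lt : h 2 < h 0
  lt_upper : h 0 < h 1
  /-- the upper outer cap contains the upper pole of a hyperbolic sphere -/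
  upper_sphere : κ 1 < 0 ∧ 0 < h 1 + 2 / κ 1
  /-- the lower outer cap contains the lower pole of a hyperbolic sphere -/
  lower_sphere : 0 < κ 2
  /-- the three caps end in the same circle -/
  common_circle : ∀ i j θ, cap (h i) (κ i) (ℓ i) θ = cap (h j) (κ j) (ℓ j) θ
  /-- at each point of this circle the outward conormals of two caps make an angle of `120°` -/
  angle_eq : ∀ i j, i ≠ j → ∀ θ,
    hypAngle (cap (h i) (κ i) (ℓ i) θ)
      (partialFst (cap (h i) (κ i)) (ℓ i) θ) (partialFst (cap (h j) (κ j)) (ℓ j) θ)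
      = 2 * Real.pi / 3

namespace StandardDoubleBubble

/-- Everything enclosed by the double bubble, up to a null set: the union of the two balls whose
bounding spheres carry the outer caps. -/
def enclosed (B : StandardDoubleBubble) : Set (ℂ × ℝ) :=
  belowSide (B.h 1) (B.κ 1) ∪ aboveSide (B.h 2) (B.κ 2)

/-- The region between the inner cap and the upper outer cap. -/
def upperRegion (B : StandardDoubleBubble) : Set (ℂ × ℝ) :=
  B.enclosed ∩ aboveSide (B.h 0) (B.κ 0)

/-- The region between the inner cap and the lower outer cap. -/
def lowerRegion (B : StandardDoubleBubble) : Set (ℂ × ℝ) :=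
  B.enclosed ∩ belowSide (B.h 0) (B.κ 0)

/-- The total area of the three caps. -/
def area (B : StandardDoubleBubble) : ℝ := ∑ i, capArea (B.h i) (B.κ i) (B.ℓ i)

end StandardDoubleBubble

/-- `doubleBubbleArea v w` is the area `A(v, w)` of the standard double bubble that encloses and
separates regions of volumes `v` and `w`. -/
def doubleBubbleArea (v w : ℝ) : ℝ :=
  Classical.epsilon fun a : ℝ => ∃ B : StandardDoubleBubble,
    hypVolume B.upperRegion = ENNReal.ofReal v ∧
    hypVolume B.lowerRegion = ENNReal.ofReal w ∧ a = B.area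

/-- The Hutchings function `F(v, w) = 2 A(v/2) + A(w) + A(v + w) - 2 A(v, w)` of `H³`. -/
def hutchings (v w : ℝ) : ℝ :=
  2 * sphereArea (v / 2) + sphereArea w + sphereArea (v + w) - 2 * doubleBubbleArea v w

end HypBubble

end

namespace HypBubble

/-! ### Profile curves and the area of a cap -/

/-! The derivative of area with respect to enclosed volume is twice a mean curvature. For a sphere
of radius `r` it is `2 coth r`; for the double bubble, `∂A(v,w)/∂v = 2H` with `H` the mean curvature
of the outer cap around the region of volume `v`. Hence `∂F/∂v = 2 coth r_A + 2 coth r_C - 4H`,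
where `r_A` and `r_C` are the radii of balls of volumes `v/2` and `v + w`. The region of volume `v`
lies in the ball whose sphere carries its outer cap (`bubbleVol_fst_le`), so `H = coth r_B` for a
ball of volume at least `v`, and it remains to prove `2 coth r_B < coth r_A + coth r_C`
(`curvature_inequality`). With `E = exp (2r)` one has `coth r = 1 + 2/(E - 1)`, and the volume `π
(sinh 2r - 2r)` shows that `E - 1` is `2V/π` up to a logarithmic correction. To leading order
`1/(v/2)` balances `2/v`; the surplus `1/(v+w)`, at least `1/(2.181 v)` because `v ≥ λ w`, absorbs
the corrections once `v ≥ 127`.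

The longer task is to see that `A(v,w)`, defined only by a choice, is a differentiable function.
Volumes and area of a double bubble are explicit functions of the mean curvatures `u = (u₁, u₂)` of
its outer caps, and these range over exactly `(1,∞)²` (`curv_mem_quadrant`,
`exists_bubble_of_mem_quadrant`). In these coordinates the Jacobian of the volumes is negative
definite (`bubbleVolDeriv_inner_neg`), so volumes determine `u` (`injOn_bubbleVol`). Every pair of
positive volumes occurs, by minimising the Legendre dual of the area plus a linear function
(`exists_bubbleVol_eq`). The inverse function theorem and the first variation formula
`hasDerivAt_bubbleArea` then give `∂A/∂v = 2u₁`. -/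

lemma mul_profileRadius (κ s : ℝ) : κ * profileRadius κ s = Real.sin (κ * s) := by
  rcases eq_or_ne κ 0 with rfl | hκ
  · simp
  · unfold profileRadius
    rw [intervalIntegral.integral_comp_mul_left (fun u => Real.cos u) hκ]
    simp [hκ]

lemma mul_profileHeight_sub (h κ s : ℝ) :
    κ * (profileHeight h κ s - h) = 1 - Real.cos (κ * s) := by
  rcases eq_or_ne κ 0 with rfl | hκ
  · simp
  · unfold profileHeight
    rw [intervalIntegral.integral_comp_mul_left (fun u => Real.sin u) hκ]
    simp [hκ]

lemma profileRadius_zero_left (s : ℝ) : profileRadius 0 s = s := by simp [profileRadius]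

lemma profileHeight_zero_curvature (h s : ℝ) : profileHeight h 0 s = h := by simp [profileHeight]

lemma profileRadius_at_zero (κ : ℝ) : profileRadius κ 0 = 0 := by simp [profileRadius]

lemma profileHeight_at_zero (h κ : ℝ) : profileHeight h κ 0 = h := by simp [profileHeight]

lemma hasDerivAt_profileRadius (κ s : ℝ) :
    HasDerivAt (profileRadius κ) (Real.cos (κ * s)) s := by
  have hc : Continuous fun u : ℝ => Real.cos (κ * u) := by fun_prop
  exact intervalIntegral.integral_hasDerivAt_right (hc.intervalIntegrable _ _)
    (hc.stronglyMeasurableAtFilter _ _) hc.continuousAt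

lemma hasDerivAt_profileHeight (h κ s : ℝ) :
    HasDerivAt (profileHeight h κ) (Real.sin (κ * s)) s := by
  have hc : Continuous fun u : ℝ => Real.sin (κ * u) := by fun_prop
  exact (intervalIntegral.integral_hasDerivAt_right (hc.intervalIntegrable _ _)
    (hc.stronglyMeasurableAtFilter _ _) hc.continuousAt).const_add h

lemma continuous_profileRadius (κ : ℝ) : Continuous (profileRadius κ) :=
  continuous_iff_continuousAt.2 fun s => (hasDerivAt_profileRadius κ s).continuousAt

lemma continuous_profileHeight (h κ : ℝ) : Continuous (profileHeight h κ) :=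
  continuous_iff_continuousAt.2 fun s => (hasDerivAt_profileHeight h κ s).continuousAt

lemma profileRadius_mul_sin (h κ s : ℝ) :
    profileRadius κ s * Real.sin (κ * s) =
      (profileHeight h κ s - h) * (1 + Real.cos (κ * s)) := by
  rcases eq_or_ne κ 0 with rfl | hκ
  · simp [profileHeight_zero_curvature]
  · apply mul_left_cancel₀ hκ
    rw [← mul_assoc, ← mul_assoc, mul_profileRadius, mul_profileHeight_sub]
    linear_combination Real.sin_sq_add_cos_sq (κ * s)

lemma profileRadius_mul_one_sub_cos (h κ s : ℝ) :
    profileRadius κ s * (1 - Real.cos (κ * s)) =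
      (profileHeight h κ s - h) * Real.sin (κ * s) := by
  rcases eq_or_ne κ 0 with rfl | hκ
  · simp
  · apply mul_left_cancel₀ hκ
    rw [← mul_assoc, ← mul_assoc, mul_profileRadius, mul_profileHeight_sub]
    ring

lemma profileRadius_pos {κ s : ℝ} (hs : 0 < s) (harc : |κ| * s < Real.pi) :
    0 < profileRadius κ s := by
  rcases lt_trichotomy κ 0 with hκ | rfl | hκ
  · rw [abs_of_neg hκ] at harc
    have h1 : Real.sin (κ * s) < 0 :=
      Real.sin_neg_of_neg_of_neg_pi_lt (mul_neg_of_neg_of_pos hκ hs) (by linarith)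
    rw [← mul_profileRadius] at h1
    exact pos_of_mul_neg_right h1 hκ.le
  · rwa [profileRadius_zero_left]
  · rw [abs_of_pos hκ] at harc
    have h1 : 0 < Real.sin (κ * s) := Real.sin_pos_of_pos_of_lt_pi (by positivity) harc
    rw [← mul_profileRadius] at h1
    exact pos_of_mul_pos_right h1 hκ.le

lemma profileRadius_nonneg {κ s : ℝ} (hs : 0 ≤ s) (harc : |κ| * s ≤ Real.pi) :
    0 ≤ profileRadius κ s := by
  rcases lt_trichotomy κ 0 with hκ | rfl | hκ
  · rw [abs_of_neg hκ] at harc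
    have h1 : Real.sin (κ * s) ≤ 0 :=
      Real.sin_nonpos_of_nonpos_of_neg_pi_le (mul_nonpos_of_nonpos_of_nonneg hκ.le hs) (by linarith)
    rw [← mul_profileRadius] at h1
    exact nonneg_of_mul_nonpos_right h1 hκ
  · rwa [profileRadius_zero_left]
  · rw [abs_of_pos hκ] at harc
    have h1 : 0 ≤ Real.sin (κ * s) := Real.sin_nonneg_of_nonneg_of_le_pi (by positivity) harc
    rw [← mul_profileRadius] at h1
    exact nonneg_of_mul_nonneg_right h1 hκ

/-- The height is positive along an arc whose two ends have positive height. -/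
lemma profileHeight_pos {h κ ℓ s : ℝ} (hh : 0 < h) (hT : 0 < profileHeight h κ ℓ)
    (hs : 0 ≤ s) (hsl : s ≤ ℓ) (harc : |κ| * ℓ ≤ Real.pi) : 0 < profileHeight h κ s := by
  rcases le_or_gt 0 κ with hκ | hκ
  · rcases hκ.eq_or_lt with rfl | hκ
    · rwa [profileHeight_zero_curvature]
    · have h1 := mul_profileHeight_sub h κ s
      have h2 := Real.cos_le_one (κ * s)
      nlinarith [nonneg_of_mul_nonneg_right (a := κ) (b := profileHeight h κ s - h)
        (by linarith) hκ]
  · rw [abs_of_neg hκ] at harc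
    have h1 := mul_profileHeight_sub h κ s
    have h2 := mul_profileHeight_sub h κ ℓ
    have h3 : Real.cos (κ * ℓ) ≤ Real.cos (κ * s) := by
      rw [← Real.cos_neg (κ * ℓ), ← Real.cos_neg (κ * s)]
      apply Real.cos_le_cos_of_nonneg_of_le_pi
      · nlinarith
      · linarith
      · nlinarith
    by_contra hc
    push Not at hc
    nlinarith

lemma hasDerivAt_cap_fst (h κ s θ : ℝ) :
    HasDerivAt (fun x => cap h κ x θ)
      ((Real.cos (κ * s) : ℂ) * Complex.exp (θ * Complex.I), Real.sin (κ * s)) s :=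
  ((hasDerivAt_profileRadius κ s).ofReal_comp.mul_const _).prodMk (hasDerivAt_profileHeight h κ s)

lemma hasDerivAt_cap_snd (h κ s θ : ℝ) :
    HasDerivAt (fun y => cap h κ s y)
      ((profileRadius κ s : ℂ) * (Complex.exp (θ * Complex.I) * Complex.I), 0) θ := by
  refine HasDerivAt.prodMk ?_ (hasDerivAt_const _ _)
  apply HasDerivAt.const_mul
  have h1 : HasDerivAt (fun y : ℝ => (y : ℂ) * Complex.I) (1 * Complex.I) θ :=
    (Complex.ofRealCLM.hasDerivAt (x := θ)).mul_const Complex.I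
  simpa using h1.cexp

lemma partialFst_cap (h κ s θ : ℝ) : partialFst (cap h κ) s θ =
    ((Real.cos (κ * s) : ℂ) * Complex.exp (θ * Complex.I), Real.sin (κ * s)) :=
  (hasDerivAt_cap_fst h κ s θ).deriv

lemma partialSnd_cap (h κ s θ : ℝ) : partialSnd (cap h κ) s θ =
    ((profileRadius κ s : ℂ) * (Complex.exp (θ * Complex.I) * Complex.I), 0) :=
  (hasDerivAt_cap_snd h κ s θ).deriv

lemma mul_exp_mul_conj_re (a b θ : ℝ) :
    (((a : ℂ) * Complex.exp (θ * Complex.I)) *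
      (starRingEnd ℂ) ((b : ℂ) * Complex.exp (θ * Complex.I))).re = a * b := by
  have h1 : Complex.exp (θ * Complex.I) * (starRingEnd ℂ) (Complex.exp (θ * Complex.I)) = 1 := by
    rw [Complex.mul_conj, Complex.normSq_eq_norm_sq, Complex.norm_exp_ofReal_mul_I]; simp
  rw [map_mul, Complex.conj_ofReal]
  have h2 : ((a : ℂ) * Complex.exp (θ * Complex.I)) *
      ((b : ℂ) * (starRingEnd ℂ) (Complex.exp (θ * Complex.I))) = ((a * b : ℝ) : ℂ) := by
    push_cast
    linear_combination (a * b : ℂ) * h1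
  rw [h2, Complex.ofReal_re]

lemma area_density_cap (h κ s θ : ℝ) :
    hypMetric (cap h κ s θ) (partialFst (cap h κ) s θ) (partialFst (cap h κ) s θ)
        * hypMetric (cap h κ s θ) (partialSnd (cap h κ) s θ) (partialSnd (cap h κ) s θ)
      - hypMetric (cap h κ s θ) (partialFst (cap h κ) s θ) (partialSnd (cap h κ) s θ) ^ 2
      = (profileRadius κ s / profileHeight h κ s ^ 2) ^ 2 := by
  have h11 : hypMetric (cap h κ s θ) (partialFst (cap h κ) s θ) (partialFst (cap h κ) s θ)
      = 1 / profileHeight h κ s ^ 2 := by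
    rw [partialFst_cap]
    simp only [hypMetric, mul_exp_mul_conj_re, cap]
    rw [← Real.sin_sq_add_cos_sq (κ * s)]
    ring
  have h22 : hypMetric (cap h κ s θ) (partialSnd (cap h κ) s θ) (partialSnd (cap h κ) s θ)
      = profileRadius κ s ^ 2 / profileHeight h κ s ^ 2 := by
    rw [partialSnd_cap]
    simp only [hypMetric, cap, map_mul, Complex.conj_ofReal, Complex.conj_I]
    have h1 := mul_exp_mul_conj_re (profileRadius κ s) (profileRadius κ s) θ
    rw [map_mul, Complex.conj_ofReal] at h1
    rw [show (profileRadius κ s : ℂ) * (Complex.exp (θ * Complex.I) * Complex.I) *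
        ((profileRadius κ s : ℂ) * ((starRingEnd ℂ) (Complex.exp (θ * Complex.I)) * -Complex.I)) =
        (profileRadius κ s : ℂ) * Complex.exp (θ * Complex.I) *
        ((profileRadius κ s : ℂ) * (starRingEnd ℂ) (Complex.exp (θ * Complex.I))) by
          linear_combination (-(profileRadius κ s : ℂ) * Complex.exp (θ * Complex.I) *
        ((profileRadius κ s : ℂ) * (starRingEnd ℂ) (Complex.exp (θ * Complex.I))))
          * Complex.I_sq, h1]
    ring
  have h12 : hypMetric (cap h κ s θ) (partialFst (cap h κ) s θ) (partialSnd (cap h κ) s θ)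
      = 0 := by
    rw [partialFst_cap, partialSnd_cap]
    simp only [hypMetric, map_mul, Complex.conj_ofReal, Complex.conj_I]
    generalize Real.cos (κ * s) = c
    have h1 : Complex.exp (θ * Complex.I) *
        (starRingEnd ℂ) (Complex.exp (θ * Complex.I)) = 1 := by
      rw [Complex.mul_conj, Complex.normSq_eq_norm_sq, Complex.norm_exp_ofReal_mul_I]; simp
    rw [show (c : ℂ) * Complex.exp (θ * Complex.I) *
        ((profileRadius κ s : ℂ) * ((starRingEnd ℂ) (Complex.exp (θ * Complex.I)) * -Complex.I)) =
        ((-(c * profileRadius κ s) : ℝ) : ℂ) * Complex.I by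
          push_cast
          linear_combination (-(c : ℂ) * profileRadius κ s * Complex.I) * h1]
    simp
  rw [h11, h22, h12]
  ring

/-- The primitive is `cosh d - 1`, with `d` the hyperbolic distance from the pole to the point of
the arc: a cap has the area of a geodesic disc of radius `d`, whatever its curvature. -/
lemma hasDerivAt_cap_area {h κ s : ℝ} (hh : h ≠ 0) (ht : profileHeight h κ s ≠ 0) :
    HasDerivAt (fun x => (profileRadius κ x ^ 2 + (profileHeight h κ x - h) ^ 2) /
      (2 * h * profileHeight h κ x)) (profileRadius κ s / profileHeight h κ s ^ 2) s := by
  have hr := hasDerivAt_profileRadius κ s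
  have hp := hasDerivAt_profileHeight h κ s
  refine (((hr.pow 2).add ((hp.sub_const h).pow 2)).div (hp.const_mul (2 * h))
    (mul_ne_zero (mul_ne_zero two_ne_zero hh) ht)).congr_deriv ?_
  have e1 := profileRadius_mul_sin h κ s
  have e2 := profileRadius_mul_one_sub_cos h κ s
  simp only [Pi.add_apply, Pi.pow_apply]
  generalize profileRadius κ s = r at *
  generalize hτ : profileHeight h κ s = t at *
  generalize Real.sin (κ * s) = S at *
  generalize Real.cos (κ * s) = c at *
  field_simp
  push_cast
  linear_combination (-r) * e1 + (t + h) * (-e2)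

/-- The area of a cap in terms of its pole and the circle in which it ends. -/
theorem capArea_eq {h κ ℓ : ℝ} (hh : 0 < h) (hℓ : 0 ≤ ℓ) (harc : |κ| * ℓ ≤ Real.pi)
    (hT : 0 < profileHeight h κ ℓ) :
    capArea h κ ℓ = Real.pi * (profileRadius κ ℓ ^ 2 + (profileHeight h κ ℓ - h) ^ 2) /
      (h * profileHeight h κ ℓ) := by
  have hpos : ∀ s ∈ Set.Icc 0 ℓ, 0 < profileHeight h κ s := fun s hs =>
    profileHeight_pos hh hT hs.1 hs.2 harc
  have hrad : ∀ s ∈ Set.Icc 0 ℓ, 0 ≤ profileRadius κ s := fun s hs =>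
    profileRadius_nonneg hs.1
      ((mul_le_mul_of_nonneg_left hs.2 (abs_nonneg κ)).trans harc)
  have h1 : capArea h κ ℓ = ∫ q in Set.Icc 0 ℓ ×ˢ Set.Icc 0 (2 * Real.pi),
      (profileRadius κ q.1 / profileHeight h κ q.1 ^ 2) * (fun _ : ℝ => (1 : ℝ)) q.2 := by
    unfold capArea surfaceArea
    apply setIntegral_congr_fun (measurableSet_Icc.prod measurableSet_Icc)
    intro q hq
    simp only [area_density_cap]
    rw [Real.sqrt_sq (div_nonneg (hrad _ hq.1) (sq_nonneg _)), mul_one]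
  rw [h1, Measure.volume_eq_prod]
  refine (setIntegral_prod_mul (L := ℝ) (fun s => profileRadius κ s / profileHeight h κ s ^ 2)
    (fun _ => 1) _ _).trans ?_
  have h2 : ∫ s in Set.Icc 0 ℓ, profileRadius κ s / profileHeight h κ s ^ 2 =
      (profileRadius κ ℓ ^ 2 + (profileHeight h κ ℓ - h) ^ 2) / (2 * h * profileHeight h κ ℓ) := by
    rw [integral_Icc_eq_integral_Ioc, ← intervalIntegral.integral_of_le hℓ,
      intervalIntegral.integral_eq_sub_of_hasDerivAt
        (f := fun x => (profileRadius κ x ^ 2 + (profileHeight h κ x - h) ^ 2) /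
          (2 * h * profileHeight h κ x))]
    · simp [profileRadius_at_zero, profileHeight_at_zero]
    · intro s hs
      rw [Set.uIcc_of_le hℓ] at hs
      exact hasDerivAt_cap_area hh.ne' (hpos s hs).ne'
    · apply ContinuousOn.intervalIntegrable
      rw [Set.uIcc_of_le hℓ]
      exact (continuous_profileRadius κ).continuousOn.div
        ((continuous_profileHeight h κ).pow 2).continuousOn fun s hs => (pow_pos (hpos s hs) 2).ne'
  rw [h2]
  have h3 : ∫ _ in Set.Icc 0 (2 * Real.pi), (1 : ℝ) = 2 * Real.pi := by
    simp [Real.pi_pos.le]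
  rw [h3]
  field_simp

/-- The chord of a circular arc makes half the turning angle with the initial tangent, which is
horizontal here. -/
lemma profileHeight_sub_eq_mul_tan {h κ ℓ : ℝ} (hφ : κ * ℓ ∈ Set.Ioo (-Real.pi) Real.pi) :
    profileHeight h κ ℓ - h = profileRadius κ ℓ * Real.tan (κ * ℓ / 2) := by
  have hc : 0 < Real.cos (κ * ℓ / 2) :=
    Real.cos_pos_of_mem_Ioo ⟨by linarith [hφ.1], by linarith [hφ.2]⟩
  have e1 := profileRadius_mul_sin h κ ℓ
  have h1 : Real.sin (κ * ℓ) = 2 * Real.sin (κ * ℓ / 2) * Real.cos (κ * ℓ / 2) := by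
    rw [← Real.sin_two_mul]; congr 1; ring
  have h2 : Real.cos (κ * ℓ) = 2 * Real.cos (κ * ℓ / 2) ^ 2 - 1 := by
    rw [← Real.cos_two_mul]; congr 1; ring
  rw [h1, h2] at e1
  rw [Real.tan_eq_sin_div_cos]
  field_simp
  have h3 : (2 * Real.cos (κ * ℓ / 2)) * ((profileHeight h κ ℓ - h) * Real.cos (κ * ℓ / 2)) =
      (2 * Real.cos (κ * ℓ / 2)) * (profileRadius κ ℓ * Real.sin (κ * ℓ / 2)) := by
    linear_combination -e1
  exact mul_left_cancel₀ (by positivity) h3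

lemma eq_of_cos_eq_neg_half {δ : ℝ} (h0 : 0 < δ) (h2 : δ < 2 * Real.pi)
    (hc : Real.cos δ = -1 / 2) : δ = 2 * Real.pi / 3 ∨ δ = 4 * Real.pi / 3 := by
  have hpi := Real.pi_pos
  have hv : Real.cos (2 * Real.pi / 3) = -1 / 2 := by
    rw [show 2 * Real.pi / 3 = Real.pi - Real.pi / 3 by ring, Real.cos_pi_sub,
    Real.cos_pi_div_three]
    norm_num
  rcases le_or_gt δ Real.pi with h | h
  · left
    exact Real.injOn_cos ⟨h0.le, h⟩ ⟨by positivity, by linarith⟩ (hc.trans hv.symm)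
  · right
    have h1 : Real.cos (2 * Real.pi - δ) = -1 / 2 := by rw [Real.cos_two_pi_sub, hc]
    have := Real.injOn_cos (x₁ := 2 * Real.pi - δ) (x₂ := 2 * Real.pi / 3)
      ⟨by linarith, by linarith⟩ ⟨by positivity, by linarith⟩ (h1.trans hv.symm)
    linarith

lemma hypAngle_cap {h κ ℓ h' κ' ℓ' θ : ℝ} (hT : 0 < profileHeight h κ ℓ) :
    hypAngle (cap h κ ℓ θ) (partialFst (cap h κ) ℓ θ) (partialFst (cap h' κ') ℓ' θ) =
      Real.arccos (Real.cos (κ * ℓ - κ' * ℓ')) := by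
  unfold hypAngle
  rw [partialFst_cap, partialFst_cap]
  simp only [hypMetric, mul_exp_mul_conj_re]
  have hc : (cap h κ ℓ θ).2 = profileHeight h κ ℓ := rfl
  have hs : ∀ a : ℝ, √((Real.cos a * Real.cos a + Real.sin a * Real.sin a) /
      profileHeight h κ ℓ ^ 2) = 1 / profileHeight h κ ℓ := by
    intro a
    rw [show (Real.cos a * Real.cos a + Real.sin a * Real.sin a) / profileHeight h κ ℓ ^ 2 =
      (1 / profileHeight h κ ℓ) ^ 2 by
        rw [show Real.cos a * Real.cos a + Real.sin a * Real.sin a = 1 by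
          linear_combination Real.sin_sq_add_cos_sq a]
        ring, Real.sqrt_sq (by positivity)]
  rw [hc, hs, hs, Real.cos_sub]
  congr 1
  field_simp

/-! ### Turning angles of the three arcs -/

namespace StandardDoubleBubble

variable (B : StandardDoubleBubble)

/-- Euclidean radius of the common circle. -/
noncomputable def circleRadius : ℝ := profileRadius (B.κ 0) (B.ℓ 0)

/-- Height of the common circle. -/
noncomputable def circleHeight : ℝ := profileHeight (B.h 0) (B.κ 0) (B.ℓ 0)

/-- The angle by which the `i`-th generating arc turns. -/
noncomputable def turn (i : Fin 3) : ℝ := B.κ i * B.ℓ i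

lemma profileRadius_eq (i : Fin 3) : profileRadius (B.κ i) (B.ℓ i) = B.circleRadius := by
  have := congrArg Prod.fst (B.common_circle i 0 0)
  simpa [cap, circleRadius] using this

lemma profileHeight_eq (i : Fin 3) :
    profileHeight (B.h i) (B.κ i) (B.ℓ i) = B.circleHeight :=
  congrArg Prod.snd (B.common_circle i 0 0)

lemma turn_mem (i : Fin 3) : B.turn i ∈ Set.Ioo (-Real.pi) Real.pi := by
  have := B.arc_lt i
  rw [← abs_of_pos (B.ℓ_pos i), ← abs_mul] at this
  exact abs_lt.1 this

lemma circleRadius_pos : 0 < B.circleRadius := profileRadius_pos (B.ℓ_pos 0) (B.arc_lt 0)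

lemma circleHeight_pos : 0 < B.circleHeight := by
  have h1 := mul_profileHeight_sub (B.h 2) (B.κ 2) (B.ℓ 2)
  rw [B.profileHeight_eq] at h1
  have h2 : 0 ≤ B.circleHeight - B.h 2 :=
    nonneg_of_mul_nonneg_right (by linarith [Real.cos_le_one (B.κ 2 * B.ℓ 2)]) B.lower_sphere
  linarith [B.h_pos 2]

lemma κ_mul_circleRadius (i : Fin 3) : B.κ i * B.circleRadius = Real.sin (B.turn i) := by
  rw [← B.profileRadius_eq i, mul_profileRadius, turn]

lemma κ_mul_circleHeight_sub (i : Fin 3) :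
    B.κ i * (B.circleHeight - B.h i) = 1 - Real.cos (B.turn i) := by
  rw [← B.profileHeight_eq i, mul_profileHeight_sub, turn]

lemma circleHeight_sub_eq (i : Fin 3) :
    B.circleHeight - B.h i = B.circleRadius * Real.tan (B.turn i / 2) := by
  have := profileHeight_sub_eq_mul_tan (h := B.h i) (B.turn_mem i)
  rwa [B.profileHeight_eq, B.profileRadius_eq] at this

lemma circleRadius_mul_sin (i : Fin 3) :
    B.circleRadius * Real.sin (B.turn i) =
      (B.circleHeight - B.h i) * (1 + Real.cos (B.turn i)) := by
  have := profileRadius_mul_sin (B.h i) (B.κ i) (B.ℓ i)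
  rwa [B.profileHeight_eq, B.profileRadius_eq] at this

/-- The arcs end at the same point, so by the half-angle formula a lower pole means a larger turn.
This orders the turns without any sign of curvature. -/
lemma turn_lt_turn {i j : Fin 3} (h : B.h i < B.h j) : B.turn j < B.turn i := by
  have hi := B.turn_mem i
  have hj := B.turn_mem j
  have h1 : Real.tan (B.turn j / 2) < Real.tan (B.turn i / 2) := by
    have := B.circleHeight_sub_eq i
    have := B.circleHeight_sub_eq j
    exact lt_of_mul_lt_mul_left (by linarith) B.circleRadius_pos.le
  have h2 := (Real.strictMonoOn_tan.lt_iff_lt (a := B.turn j / 2) (b := B.turn i / 2)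
    ⟨by linarith [hj.1], by linarith [hj.2]⟩ ⟨by linarith [hi.1], by linarith [hi.2]⟩).1 h1
  linarith

lemma cos_turn_sub {i j : Fin 3} (hij : i ≠ j) : Real.cos (B.turn i - B.turn j) = -1 / 2 := by
  have h1 := B.angle_eq i j hij 0
  rw [hypAngle_cap (by rw [B.profileHeight_eq]; exact B.circleHeight_pos)] at h1
  have h2 := congrArg Real.cos h1
  rw [Real.cos_arccos (Real.neg_one_le_cos _) (Real.cos_le_one _)] at h2
  rw [turn, turn, h2, show 2 * Real.pi / 3 = Real.pi - Real.pi / 3 by ring, Real.cos_pi_sub,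
    Real.cos_pi_div_three]
  norm_num

/-- The angle condition only leaves 120° or 240° for each of the two consecutive differences. Their
sum is less than 360° because all turns lie in `(-π, π)`, so both are 120°. -/
lemma turn_two_and_one : B.turn 2 = B.turn 0 + 2 * Real.pi / 3 ∧
    B.turn 1 = B.turn 0 - 2 * Real.pi / 3 := by
  have hpi := Real.pi_pos
  have h20 := B.turn_lt_turn B.lower_lt
  have h01 := B.turn_lt_turn B.lt_upper
  have m2 := (B.turn_mem 2).2
  have m1 := (B.turn_mem 1).1
  rcases eq_of_cos_eq_neg_half (δ := B.turn 2 - B.turn 0) (by linarith) (by linarith)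
    (B.cos_turn_sub (by decide)) with h | h <;>
  rcases eq_of_cos_eq_neg_half (δ := B.turn 0 - B.turn 1) (by linarith) (by linarith)
    (B.cos_turn_sub (by decide)) with h' | h' <;>
  constructor <;> linarith

lemma turn_two : B.turn 2 = B.turn 0 + 2 * Real.pi / 3 := B.turn_two_and_one.1

lemma turn_one : B.turn 1 = B.turn 0 - 2 * Real.pi / 3 := B.turn_two_and_one.2

end StandardDoubleBubble

/-! ### Volumes by horizontal slices -/

lemma volume_norm_sq_lt (g : ℝ) : volume {ζ : ℂ | ‖ζ‖ ^ 2 < g} = ENNReal.ofReal (Real.pi * g) := by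
  rcases le_or_gt g 0 with hg | hg
  · rw [ENNReal.ofReal_of_nonpos (mul_nonpos_of_nonneg_of_nonpos Real.pi_pos.le hg)]
    convert measure_empty (μ := (volume : Measure ℂ))
    ext ζ
    simpa using hg.trans (sq_nonneg ‖ζ‖)
  · have : {ζ : ℂ | ‖ζ‖ ^ 2 < g} = Metric.ball 0 (√g) := by
      ext ζ
      simp [Real.lt_sqrt (norm_nonneg ζ)]
    rw [this, Complex.volume_ball, ← ENNReal.ofReal_pow (Real.sqrt_nonneg g), Real.sq_sqrt hg.le,
      mul_comm, ENNReal.ofReal_mul Real.pi_pos.le]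
    congr 1
    rw [← NNReal.coe_real_pi, ENNReal.ofReal_coe_nnreal]

lemma volume_norm_sq_le (g : ℝ) : volume {ζ : ℂ | ‖ζ‖ ^ 2 ≤ g} = ENNReal.ofReal (Real.pi * g) := by
  rcases lt_or_ge g 0 with hg | hg
  · rw [ENNReal.ofReal_of_nonpos (mul_nonpos_of_nonneg_of_nonpos Real.pi_pos.le hg.le)]
    convert measure_empty (μ := (volume : Measure ℂ))
    ext ζ
    simpa using hg.trans_le (sq_nonneg ‖ζ‖)
  · have : {ζ : ℂ | ‖ζ‖ ^ 2 ≤ g} = Metric.closedBall 0 (√g) := by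
      ext ζ
      simp [Real.le_sqrt (norm_nonneg ζ) hg]
    rw [this, Complex.volume_closedBall, ← ENNReal.ofReal_pow (Real.sqrt_nonneg g),
      Real.sq_sqrt hg, mul_comm, ENNReal.ofReal_mul Real.pi_pos.le]
    congr 1
    rw [← NNReal.coe_real_pi, ENNReal.ofReal_coe_nnreal]

lemma volume_annulus {a b : ℝ} (hab : a ≤ b) :
    volume {ζ : ℂ | a < ‖ζ‖ ^ 2 ∧ ‖ζ‖ ^ 2 < b} =
      ENNReal.ofReal (Real.pi * max b 0 - Real.pi * max a 0) := by
  rcases hab.eq_or_lt with rfl | hab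
  · rw [sub_self, ENNReal.ofReal_zero]
    convert measure_empty (μ := (volume : Measure ℂ))
    ext ζ
    simp only [Set.mem_ofPred_eq, Set.mem_empty_iff_false, iff_false, not_and, not_lt]
    exact fun h => h.le
  · have h1 : {ζ : ℂ | a < ‖ζ‖ ^ 2 ∧ ‖ζ‖ ^ 2 < b} =
        {ζ : ℂ | ‖ζ‖ ^ 2 < b} \ {ζ : ℂ | ‖ζ‖ ^ 2 ≤ a} := by
      ext ζ
      simp [and_comm]
    rw [h1, measure_sdiff, volume_norm_sq_lt, volume_norm_sq_le,
      ENNReal.ofReal_sub _ (by positivity)]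
    · congr 1
      · rcases le_total b 0 with hb | hb
        · rw [max_eq_right hb, mul_zero, ENNReal.ofReal_zero, ENNReal.ofReal_of_nonpos
            (mul_nonpos_of_nonneg_of_nonpos Real.pi_pos.le hb)]
        · rw [max_eq_left hb]
      · rcases le_total a 0 with hb | hb
        · rw [max_eq_right hb, mul_zero, ENNReal.ofReal_zero, ENNReal.ofReal_of_nonpos
            (mul_nonpos_of_nonneg_of_nonpos Real.pi_pos.le hb)]
        · rw [max_eq_left hb]
    · intro ζ h
      exact lt_of_le_of_lt h hab
    · exact (measurableSet_le (by fun_prop) (by fun_prop)).nullMeasurableSet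
    · rw [volume_norm_sq_le]; exact ENNReal.ofReal_ne_top

lemma hypVolume_eq_lintegral_slice {E : Set (ℂ × ℝ)} (hE : MeasurableSet E) :
    hypVolume E = ∫⁻ t in Set.Ioi (0 : ℝ),
      ENNReal.ofReal (1 / t ^ 3) * volume {ζ : ℂ | (ζ, t) ∈ E} := by
  have hU : MeasurableSet upperHalfSpace := measurableSet_lt measurable_const measurable_snd
  have hm : Measurable fun p : ℂ × ℝ => ENNReal.ofReal (1 / p.2 ^ 3) := by fun_prop
  rw [hypVolume, ← lintegral_indicator (hE.inter hU), Measure.volume_eq_prod,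
    lintegral_prod_symm _ (hm.indicator (hE.inter hU)).aemeasurable,
    ← lintegral_indicator measurableSet_Ioi]
  congr 1
  funext t
  by_cases ht : 0 < t
  · rw [Set.indicator_of_mem (by exact ht)]
    have hs : MeasurableSet {ζ : ℂ | (ζ, t) ∈ E} := measurable_prodMk_right hE
    rw [← lintegral_indicator_const hs]
    congr 1
    funext ζ
    by_cases h : (ζ, t) ∈ E
    · rw [Set.indicator_of_mem (show (ζ, t) ∈ E ∩ upperHalfSpace from ⟨h, ht⟩),
        Set.indicator_of_mem (by exact h)]
    · rw [Set.indicator_of_notMem (fun hh => h hh.1), Set.indicator_of_notMem (by exact h)]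
  · rw [Set.indicator_of_notMem (by exact ht)]
    rw [← lintegral_zero]
    congr 1
    funext ζ
    rw [Set.indicator_of_notMem (fun hh => ht hh.2)]

/-- If almost all horizontal slices of `E` have as area the sum of `π g₁` on `(a, b)` and `ε π g₂`
on `(c, d)`, then the hyperbolic volume of `E` is the corresponding sum of integrals. -/
lemma hypVolume_eq_of_slice {E : Set (ℂ × ℝ)} (hE : MeasurableSet E) {g₁ g₂ : ℝ → ℝ}
    (hg₁ : Continuous g₁) (hg₂ : Continuous g₂) {a b c d T ε : ℝ} (ha : 0 < a) (hab : a ≤ b)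
    (hc : 0 < c) (hcd : c ≤ d)
    (hslice : ∀ t, 0 < t → t ≠ T →
      0 ≤ (Set.Ioo a b).indicator g₁ t + ε * (Set.Ioo c d).indicator g₂ t ∧
      volume {ζ : ℂ | (ζ, t) ∈ E} = ENNReal.ofReal (Real.pi *
        ((Set.Ioo a b).indicator g₁ t + ε * (Set.Ioo c d).indicator g₂ t))) :
    hypVolume E = ENNReal.ofReal
      ((∫ t in a..b, Real.pi * g₁ t / t ^ 3) + ε * ∫ t in c..d, Real.pi * g₂ t / t ^ 3) := by
  have hint : ∀ {g : ℝ → ℝ} {x y : ℝ}, Continuous g → 0 < x →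
      IntegrableOn (fun t => Real.pi * g t / t ^ 3) (Set.Ioo x y) := by
    intro g x y hg hx
    apply IntegrableOn.mono_set _ Set.Ioo_subset_Icc_self
    apply ContinuousOn.integrableOn_Icc
    exact (hg.const_mul _).continuousOn.div (by fun_prop) fun t ht =>
      (pow_pos (hx.trans_le ht.1) 3).ne'
  have i1 := (hint hg₁ ha (y := b)).integrable_indicator measurableSet_Ioo
  have i2 := ((hint hg₂ hc (y := d)).integrable_indicator measurableSet_Ioo).const_mul ε
  have e1 : ∀ {g : ℝ → ℝ} {x y : ℝ}, 0 < x → x ≤ y →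
      ∫ t in Set.Ioi (0 : ℝ), (Set.Ioo x y).indicator (fun t => Real.pi * g t / t ^ 3) t =
        ∫ t in x..y, Real.pi * g t / t ^ 3 := by
    intro g x y hx hxy
    have hsub : Set.Ioo x y ⊆ Set.Ioi 0 := fun t ht => hx.trans ht.1
    rw [setIntegral_indicator measurableSet_Ioo, Set.inter_eq_right.2 hsub, intervalIntegral.integral_of_le hxy, integral_Ioc_eq_integral_Ioo]
  rw [hypVolume_eq_lintegral_slice hE, ← e1 ha hab, ← e1 hc hcd, ← integral_const_mul,
    ← integral_add i1.integrableOn i2.integrableOn]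
  have hTz : ∀ᵐ t : ℝ ∂(volume.restrict (Set.Ioi 0)), t ≠ T :=
    ae_restrict_of_ae (Measure.ae_ne volume T)
  have key : ∀ t, Real.pi * ((Set.Ioo a b).indicator g₁ t + ε * (Set.Ioo c d).indicator g₂ t)
      / t ^ 3 = (Set.Ioo a b).indicator (fun t => Real.pi * g₁ t / t ^ 3) t +
        ε * (Set.Ioo c d).indicator (fun t => Real.pi * g₂ t / t ^ 3) t := by
    intro t
    simp only [Set.indicator_apply]
    split_ifs <;> ring
  have i3 : IntegrableOn (fun t => (Set.Ioo a b).indicator (fun t => Real.pi * g₁ t / t ^ 3) t +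
        ε * (Set.Ioo c d).indicator (fun t => Real.pi * g₂ t / t ^ 3) t) (Set.Ioi 0) :=
    (i1.add i2).integrableOn
  rw [ofReal_integral_eq_lintegral_ofReal i3]
  · apply lintegral_congr_ae
    filter_upwards [hTz, ae_restrict_mem measurableSet_Ioi] with t ht ht0
    have ht0' : (0 : ℝ) < t := ht0
    rw [(hslice t ht0 ht).2, ← key, ← ENNReal.ofReal_mul (by positivity)]
    congr 1
    ring
  · filter_upwards [hTz, ae_restrict_mem measurableSet_Ioi] with t ht ht0
    have ht0' : (0 : ℝ) < t := ht0
    simp only [Pi.zero_apply]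
    rw [← key]
    have := (hslice t ht0 ht).1
    have := Real.pi_pos
    positivity

/-- The square of the Euclidean radius of the horizontal slice at height `t` of the Euclidean ball
with pole `(0, h)` and signed curvature `κ ≠ 0`. -/
noncomputable def discSq (h κ t : ℝ) : ℝ := 2 / κ * (t - h) - (t - h) ^ 2

/-- The signed hyperbolic volume between the cap with pole `(0, h)` and the horizontal disc at
height `T`. -/
noncomputable def capVolume (h κ T : ℝ) : ℝ :=
  ∫ t in h..T, Real.pi * discSq h κ t / t ^ 3

lemma continuous_discSq (h κ : ℝ) : Continuous (discSq h κ) := by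
  unfold discSq; fun_prop

lemma discSq_eq_mul {h κ t : ℝ} : discSq h κ t = (t - h) * (h + 2 / κ - t) := by
  unfold discSq; ring

lemma capVolume_eq {h κ T : ℝ} (hh : 0 < h) (hT : 0 < T) :
    capVolume h κ T = Real.pi * (Real.log (h / T) + (T ^ 2 - h ^ 2) / (2 * h * T) +
      discSq h κ T * (T - h) / (2 * h * T ^ 2)) := by
  have hpos : ∀ t ∈ Set.uIcc h T, 0 < t := fun t ht =>
    lt_of_lt_of_le (lt_min hh hT) ht.1
  unfold capVolume
  rw [intervalIntegral.integral_eq_sub_of_hasDerivAt (f := fun t => Real.pi *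
    (-Real.log t - 2 * (h + 1 / κ) / t + (h ^ 2 + 2 * h * (1 / κ)) / (2 * t ^ 2)))]
  · rw [Real.log_div hh.ne' hT.ne']
    unfold discSq
    rw [show 2 / κ = 2 * (1 / κ) by ring]
    generalize 1 / κ = k
    field_simp
    ring
  · intro t ht
    have h0 := hpos t ht
    have d1 := (Real.hasDerivAt_log h0.ne').neg
    have d2 := (hasDerivAt_const t (2 * (h + 1 / κ))).div (hasDerivAt_id t) h0.ne'
    have d3 := (hasDerivAt_const t (h ^ 2 + 2 * h * (1 / κ))).div
      ((hasDerivAt_pow 2 t).const_mul 2) (by positivity)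
    refine (((d1.sub d2).add d3).const_mul Real.pi).congr_deriv ?_
    unfold discSq
    rw [show 2 / κ = 2 * (1 / κ) by ring]
    generalize 1 / κ = k
    simp only [id]
    field_simp
    ring
  · apply ContinuousOn.intervalIntegrable
    exact ((continuous_discSq h κ).const_mul _).continuousOn.div (by fun_prop) fun t ht =>
      (pow_pos (hpos t ht) 3).ne'

lemma indicator_discSq_below {h κ T t : ℝ} (hT : T < h + 2 / κ) (ht : t < T) :
    (Set.Ioo h T).indicator (discSq h κ) t = max (discSq h κ t) 0 := by
  rw [discSq_eq_mul]
  by_cases hm : h < t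
  · rw [Set.indicator_of_mem (show t ∈ Set.Ioo h T from ⟨hm, ht⟩), discSq_eq_mul, max_eq_left]
    exact mul_nonneg (by linarith) (by linarith)
  · rw [Set.indicator_of_notMem (fun hh => hm hh.1), max_eq_right]
    exact mul_nonpos_of_nonpos_of_nonneg (by linarith) (by linarith)

lemma indicator_discSq_above {h κ T t : ℝ} (hT : h + 2 / κ < T) (ht : T < t) :
    (Set.Ioo T h).indicator (discSq h κ) t = max (discSq h κ t) 0 := by
  rw [discSq_eq_mul]
  by_cases hm : t < h
  · rw [Set.indicator_of_mem (show t ∈ Set.Ioo T h from ⟨ht, hm⟩), discSq_eq_mul, max_eq_left]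
    exact mul_nonneg_of_nonpos_of_nonpos (by linarith) (by linarith)
  · rw [Set.indicator_of_notMem (fun hh => hm hh.2), max_eq_right]
    exact mul_nonpos_of_nonneg_of_nonpos (by linarith) (by linarith)

lemma sideFun_neg_iff_of_pos {h κ : ℝ} (hκ : 0 < κ) (p : ℂ × ℝ) :
    sideFun h κ p < 0 ↔ ‖p.1‖ ^ 2 < discSq h κ p.2 := by
  have : sideFun h κ p = κ * (‖p.1‖ ^ 2 - discSq h κ p.2) := by
    unfold sideFun discSq; field_simp; ring
  rw [this]
  exact ⟨fun h => sub_neg.1 (neg_of_mul_neg_right h hκ.le),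
    fun h => mul_neg_of_pos_of_neg hκ (sub_neg.2 h)⟩

lemma sideFun_pos_iff_of_pos {h κ : ℝ} (hκ : 0 < κ) (p : ℂ × ℝ) :
    0 < sideFun h κ p ↔ discSq h κ p.2 < ‖p.1‖ ^ 2 := by
  have : sideFun h κ p = κ * (‖p.1‖ ^ 2 - discSq h κ p.2) := by
    unfold sideFun discSq; field_simp; ring
  rw [this, mul_pos_iff_of_pos_left hκ, sub_pos]

lemma sideFun_neg_iff_of_neg {h κ : ℝ} (hκ : κ < 0) (p : ℂ × ℝ) :
    sideFun h κ p < 0 ↔ discSq h κ p.2 < ‖p.1‖ ^ 2 := by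
  have : sideFun h κ p = -κ * (discSq h κ p.2 - ‖p.1‖ ^ 2) := by
    have := hκ.ne
    unfold sideFun discSq; field_simp; ring
  rw [this]
  exact ⟨fun h => sub_neg.1 (neg_of_mul_neg_right h (neg_pos.2 hκ).le),
    fun h => mul_neg_of_pos_of_neg (neg_pos.2 hκ) (sub_neg.2 h)⟩

lemma sideFun_pos_iff_of_neg {h κ : ℝ} (hκ : κ < 0) (p : ℂ × ℝ) :
    0 < sideFun h κ p ↔ ‖p.1‖ ^ 2 < discSq h κ p.2 := by
  have : sideFun h κ p = -κ * (discSq h κ p.2 - ‖p.1‖ ^ 2) := by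
    have := hκ.ne
    unfold sideFun discSq; field_simp; ring
  rw [this, mul_pos_iff_of_pos_left (neg_pos.2 hκ), sub_pos]

lemma continuous_sideFun (h κ : ℝ) : Continuous (sideFun h κ) := by
  unfold sideFun; fun_prop

lemma measurableSet_aboveSide (h κ : ℝ) : MeasurableSet (aboveSide h κ) :=
  (measurableSet_lt measurable_const measurable_snd).inter
    (measurableSet_lt (continuous_sideFun h κ).measurable measurable_const)

lemma measurableSet_belowSide (h κ : ℝ) : MeasurableSet (belowSide h κ) :=
  (measurableSet_lt measurable_const measurable_snd).inter
    (measurableSet_lt measurable_const (continuous_sideFun h κ).measurable)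

lemma volume_norm_sq_lt_max (g : ℝ) :
    volume {ζ : ℂ | ‖ζ‖ ^ 2 < g} = ENNReal.ofReal (Real.pi * max g 0) := by
  rw [volume_norm_sq_lt]
  rcases le_total g 0 with hb | hb
  · rw [max_eq_right hb, mul_zero, ENNReal.ofReal_zero, ENNReal.ofReal_of_nonpos
      (mul_nonpos_of_nonneg_of_nonpos Real.pi_pos.le hb)]
  · rw [max_eq_left hb]

/-! ### Volumes of the two regions -/

namespace StandardDoubleBubble

variable (B : StandardDoubleBubble)

lemma upper_neg : B.κ 1 < 0 := B.upper_sphere.1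

lemma neg_one_lt_cos_turn (i : Fin 3) : -1 < Real.cos (B.turn i) := by
  have h := B.turn_mem i
  have hc : 0 < Real.cos (B.turn i / 2) :=
    Real.cos_pos_of_mem_Ioo ⟨by linarith [h.1], by linarith [h.2]⟩
  have h2 : Real.cos (B.turn i) = 2 * Real.cos (B.turn i / 2) ^ 2 - 1 := by
    rw [← Real.cos_two_mul]; congr 1; ring
  rw [h2]
  nlinarith

lemma cos_turn_lt_one {i : Fin 3} (hκ : B.κ i ≠ 0) : Real.cos (B.turn i) < 1 := by
  apply lt_of_le_of_ne (Real.cos_le_one _)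
  intro h
  have h1 : Real.sin (B.turn i) = 0 := by
    have := Real.sin_sq_add_cos_sq (B.turn i)
    rw [h] at this
    nlinarith
  rw [← B.κ_mul_circleRadius] at h1
  exact (mul_ne_zero hκ B.circleRadius_pos.ne') h1

lemma h_lt_circleHeight {i : Fin 3} (hκ : 0 < B.κ i) : B.h i < B.circleHeight := by
  have h1 := B.κ_mul_circleHeight_sub i
  have := B.cos_turn_lt_one hκ.ne'
  have := pos_of_mul_pos_right (a := B.κ i) (b := B.circleHeight - B.h i) (by linarith) hκ.le
  linarith

lemma circleHeight_lt_h {i : Fin 3} (hκ : B.κ i < 0) : B.circleHeight < B.h i := by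
  have h1 := B.κ_mul_circleHeight_sub i
  have := B.cos_turn_lt_one hκ.ne
  have := neg_of_mul_pos_right (a := B.κ i) (b := B.circleHeight - B.h i) (by linarith) hκ.le
  linarith

lemma circleHeight_lt_antipode {i : Fin 3} (hκ : 0 < B.κ i) :
    B.circleHeight < B.h i + 2 / B.κ i := by
  have h1 := B.κ_mul_circleHeight_sub i
  have := B.neg_one_lt_cos_turn i
  have : B.circleHeight - B.h i < 2 / B.κ i := by
    rw [lt_div_iff₀ hκ]; linarith
  linarith

lemma antipode_lt_circleHeight {i : Fin 3} (hκ : B.κ i < 0) :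
    B.h i + 2 / B.κ i < B.circleHeight := by
  have h1 := B.κ_mul_circleHeight_sub i
  have := B.neg_one_lt_cos_turn i
  have : 2 / B.κ i < B.circleHeight - B.h i := by
    rw [div_lt_iff_of_neg hκ]; linarith
  linarith

/-- Expanded at the height of the common circle, the profiles of the curved caps differ only in the
linear term, whose coefficient is twice the height of the Euclidean centre above the circle. Hence
comparing these slopes decides which ball has the larger slice, with opposite answers above and
below the circle. -/
lemma discSq_eq {i : Fin 3} (hκ : B.κ i ≠ 0) (t : ℝ) : discSq (B.h i) (B.κ i) t =
    B.circleRadius ^ 2 + 2 * (Real.cos (B.turn i) / B.κ i) * (t - B.circleHeight) -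
      (t - B.circleHeight) ^ 2 := by
  have h1 := B.κ_mul_circleHeight_sub i
  have h2 := B.κ_mul_circleRadius i
  have h3 := Real.sin_sq_add_cos_sq (B.turn i)
  have e1 : B.h i = B.circleHeight - (1 - Real.cos (B.turn i)) / B.κ i := by
    rw [← h1]; field_simp; ring
  have e2 : B.circleRadius = Real.sin (B.turn i) / B.κ i := by
    rw [← h2]; field_simp
  rw [e1, e2, discSq]
  field_simp
  linear_combination -h3

lemma discSq_circleHeight {i : Fin 3} (hκ : B.κ i ≠ 0) :
    discSq (B.h i) (B.κ i) B.circleHeight = B.circleRadius ^ 2 := by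
  rw [B.discSq_eq hκ]; ring

lemma slope_sub {i j : Fin 3} (hi : B.κ i ≠ 0) (hj : B.κ j ≠ 0) :
    Real.cos (B.turn i) / B.κ i - Real.cos (B.turn j) / B.κ j =
      Real.sin (B.turn j - B.turn i) / (B.κ i * B.κ j * B.circleRadius) := by
  have := B.circleRadius_pos.ne'
  rw [Real.sin_sub, ← B.κ_mul_circleRadius, ← B.κ_mul_circleRadius]
  field_simp

lemma sin_two_thirds_pos : 0 < Real.sin (2 * Real.pi / 3) :=
  Real.sin_pos_of_pos_of_lt_pi (by positivity) (by linarith [Real.pi_pos])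

lemma slope_two_lt_one :
    Real.cos (B.turn 2) / B.κ 2 < Real.cos (B.turn 1) / B.κ 1 := by
  have h := B.slope_sub B.upper_neg.ne B.lower_sphere.ne'
  have hs : Real.sin (B.turn 2 - B.turn 1) = -Real.sin (2 * Real.pi / 3) := by
    rw [B.turn_one, B.turn_two, ← Real.sin_sub_two_pi, ← Real.sin_neg]
    congr 1; ring
  have h1 : 0 < Real.sin (B.turn 2 - B.turn 1) / (B.κ 1 * B.κ 2 * B.circleRadius) := by
    rw [hs]
    exact div_pos_of_neg_of_neg (neg_lt_zero.2 sin_two_thirds_pos)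
      (mul_neg_of_neg_of_pos (mul_neg_of_neg_of_pos B.upper_neg B.lower_sphere) B.circleRadius_pos)
  linarith

lemma slope_one_lt_zero (hκ : 0 < B.κ 0) :
    Real.cos (B.turn 1) / B.κ 1 < Real.cos (B.turn 0) / B.κ 0 := by
  have h := B.slope_sub hκ.ne' B.upper_neg.ne
  have hs : Real.sin (B.turn 1 - B.turn 0) = -Real.sin (2 * Real.pi / 3) := by
    rw [B.turn_one, ← Real.sin_neg]
    congr 1; ring
  have h1 : 0 < Real.sin (B.turn 1 - B.turn 0) / (B.κ 0 * B.κ 1 * B.circleRadius) := by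
    rw [hs]
    exact div_pos_of_neg_of_neg (neg_lt_zero.2 sin_two_thirds_pos)
      (mul_neg_of_neg_of_pos (mul_neg_of_pos_of_neg hκ B.upper_neg) B.circleRadius_pos)
  linarith

lemma slope_zero_lt_two (hκ : B.κ 0 < 0) :
    Real.cos (B.turn 0) / B.κ 0 < Real.cos (B.turn 2) / B.κ 2 := by
  have h := B.slope_sub hκ.ne B.lower_sphere.ne'
  have hs : Real.sin (B.turn 2 - B.turn 0) = Real.sin (2 * Real.pi / 3) := by
    rw [B.turn_two]
    congr 1; ring
  have h1 : Real.sin (B.turn 2 - B.turn 0) / (B.κ 0 * B.κ 2 * B.circleRadius) < 0 := by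
    rw [hs]
    exact div_neg_of_pos_of_neg sin_two_thirds_pos
      (mul_neg_of_neg_of_pos (mul_neg_of_neg_of_pos hκ B.lower_sphere) B.circleRadius_pos)
  linarith

lemma discSq_lt_of_slope_lt {i j : Fin 3} (hi : B.κ i ≠ 0) (hj : B.κ j ≠ 0)
    (h : Real.cos (B.turn i) / B.κ i < Real.cos (B.turn j) / B.κ j) {t : ℝ}
    (ht : B.circleHeight < t) : discSq (B.h i) (B.κ i) t < discSq (B.h j) (B.κ j) t := by
  rw [B.discSq_eq hi, B.discSq_eq hj]
  nlinarith

lemma discSq_lt_of_lt_slope {i j : Fin 3} (hi : B.κ i ≠ 0) (hj : B.κ j ≠ 0)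
    (h : Real.cos (B.turn j) / B.κ j < Real.cos (B.turn i) / B.κ i) {t : ℝ}
    (ht : t < B.circleHeight) : discSq (B.h i) (B.κ i) t < discSq (B.h j) (B.κ j) t := by
  rw [B.discSq_eq hi, B.discSq_eq hj]
  nlinarith

lemma mem_enclosed_iff {p : ℂ × ℝ} (hp : 0 < p.2) : p ∈ B.enclosed ↔
    ‖p.1‖ ^ 2 < discSq (B.h 1) (B.κ 1) p.2 ∨ ‖p.1‖ ^ 2 < discSq (B.h 2) (B.κ 2) p.2 := by
  simp [enclosed, belowSide, aboveSide, hp, sideFun_pos_iff_of_neg B.upper_neg,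
    sideFun_neg_iff_of_pos B.lower_sphere]

lemma measurableSet_enclosed : MeasurableSet B.enclosed :=
  (measurableSet_belowSide _ _).union (measurableSet_aboveSide _ _)

lemma measurableSet_upperRegion : MeasurableSet B.upperRegion :=
  B.measurableSet_enclosed.inter (measurableSet_aboveSide _ _)

lemma measurableSet_lowerRegion : MeasurableSet B.lowerRegion :=
  B.measurableSet_enclosed.inter (measurableSet_belowSide _ _)

lemma slice_upperRegion_of_pos (hκ : 0 < B.κ 0) {t : ℝ} (ht : 0 < t) :
    {ζ : ℂ | (ζ, t) ∈ B.upperRegion} = {ζ : ℂ | (‖ζ‖ ^ 2 < discSq (B.h 1) (B.κ 1) t ∨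
      ‖ζ‖ ^ 2 < discSq (B.h 2) (B.κ 2) t) ∧ ‖ζ‖ ^ 2 < discSq (B.h 0) (B.κ 0) t} := by
  ext ζ
  simp [upperRegion, B.mem_enclosed_iff (p := (ζ, t)) ht, aboveSide, ht, sideFun_neg_iff_of_pos hκ]

lemma slice_lowerRegion_of_pos (hκ : 0 < B.κ 0) {t : ℝ} (ht : 0 < t) :
    {ζ : ℂ | (ζ, t) ∈ B.lowerRegion} = {ζ : ℂ | (‖ζ‖ ^ 2 < discSq (B.h 1) (B.κ 1) t ∨
      ‖ζ‖ ^ 2 < discSq (B.h 2) (B.κ 2) t) ∧ discSq (B.h 0) (B.κ 0) t < ‖ζ‖ ^ 2} := by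
  ext ζ
  simp [lowerRegion, B.mem_enclosed_iff (p := (ζ, t)) ht, belowSide, ht, sideFun_pos_iff_of_pos hκ]

lemma slice_upperRegion_of_neg (hκ : B.κ 0 < 0) {t : ℝ} (ht : 0 < t) :
    {ζ : ℂ | (ζ, t) ∈ B.upperRegion} = {ζ : ℂ | (‖ζ‖ ^ 2 < discSq (B.h 1) (B.κ 1) t ∨
      ‖ζ‖ ^ 2 < discSq (B.h 2) (B.κ 2) t) ∧ discSq (B.h 0) (B.κ 0) t < ‖ζ‖ ^ 2} := by
  ext ζ
  simp [upperRegion, B.mem_enclosed_iff (p := (ζ, t)) ht, aboveSide, ht, sideFun_neg_iff_of_neg hκ]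

lemma slice_lowerRegion_of_neg (hκ : B.κ 0 < 0) {t : ℝ} (ht : 0 < t) :
    {ζ : ℂ | (ζ, t) ∈ B.lowerRegion} = {ζ : ℂ | (‖ζ‖ ^ 2 < discSq (B.h 1) (B.κ 1) t ∨
      ‖ζ‖ ^ 2 < discSq (B.h 2) (B.κ 2) t) ∧ ‖ζ‖ ^ 2 < discSq (B.h 0) (B.κ 0) t} := by
  ext ζ
  simp [lowerRegion, B.mem_enclosed_iff (p := (ζ, t)) ht, belowSide, ht, sideFun_pos_iff_of_neg hκ]

lemma circleHeight_eq_of_zero (hκ : B.κ 0 = 0) : B.h 0 = B.circleHeight := by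
  rw [circleHeight, hκ, profileHeight_zero_curvature]

lemma slice_upperRegion_of_zero (hκ : B.κ 0 = 0) {t : ℝ} (ht : 0 < t) :
    {ζ : ℂ | (ζ, t) ∈ B.upperRegion} = {ζ : ℂ | (‖ζ‖ ^ 2 < discSq (B.h 1) (B.κ 1) t ∨
      ‖ζ‖ ^ 2 < discSq (B.h 2) (B.κ 2) t) ∧ B.circleHeight < t} := by
  ext ζ
  simp [upperRegion, B.mem_enclosed_iff (p := (ζ, t)) ht, aboveSide, ht, sideFun, hκ,
    B.circleHeight_eq_of_zero hκ]

lemma slice_lowerRegion_of_zero (hκ : B.κ 0 = 0) {t : ℝ} (ht : 0 < t) :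
    {ζ : ℂ | (ζ, t) ∈ B.lowerRegion} = {ζ : ℂ | (‖ζ‖ ^ 2 < discSq (B.h 1) (B.κ 1) t ∨
      ‖ζ‖ ^ 2 < discSq (B.h 2) (B.κ 2) t) ∧ t < B.circleHeight} := by
  ext ζ
  simp [lowerRegion, B.mem_enclosed_iff (p := (ζ, t)) ht, belowSide, ht, sideFun, hκ,
    B.circleHeight_eq_of_zero hκ]
  intro _
  constructor <;> intro <;> linarith

lemma slice_of_notMem_of_notMem {g₁ g₂ : ℝ → ℝ} {I J : Set ℝ} {t ε : ℝ} (h₁ : t ∉ I)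
    (h₂ : t ∉ J) {E : Set ℂ} (hE : E = ∅) :
    0 ≤ I.indicator g₁ t + ε * J.indicator g₂ t ∧
      volume E = ENNReal.ofReal (Real.pi * (I.indicator g₁ t + ε * J.indicator g₂ t)) := by
  rw [Set.indicator_of_notMem h₁, Set.indicator_of_notMem h₂, hE]
  simp

/-- The orientation in `capVolume` makes one formula serve all shapes of the inner cap: what lies
between that cap and the horizontal disc of the common circle is added or removed according to its
bulge. -/
theorem hypVolume_upperRegion : hypVolume B.upperRegion = ENNReal.ofReal
    (capVolume (B.h 0) (B.κ 0) B.circleHeight - capVolume (B.h 1) (B.κ 1) B.circleHeight) := by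
  have hT := B.circleHeight_pos
  have h1 := B.upper_neg
  have h2 := B.lower_sphere
  have hT1 := B.circleHeight_lt_h h1
  have s21 := B.slope_two_lt_one
  have a1 := fun {t} => indicator_discSq_above (t := t) (B.antipode_lt_circleHeight h1)
  have c1 := continuous_discSq (B.h 1) (B.κ 1)
  have c0 := continuous_discSq (B.h 0) (B.κ 0)
  rw [capVolume, capVolume, intervalIntegral.integral_symm B.circleHeight (B.h 1)]
  rcases lt_trichotomy (B.κ 0) 0 with h0 | h0 | h0
  -- The inner cap bulges upwards: above the circle the slices are annuli between ball `0` and ball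
  -- `1`, below it they are empty.
  · have hT0 := B.circleHeight_lt_h h0
    have s02 := B.slope_zero_lt_two h0
    rw [intervalIntegral.integral_symm B.circleHeight (B.h 0),
      hypVolume_eq_of_slice B.measurableSet_upperRegion c1 c0 hT hT1.le hT hT0.le
        (T := B.circleHeight) (ε := -1)]
    · congr 1; ring
    · intro t ht htT
      rw [B.slice_upperRegion_of_neg h0 ht]
      rcases htT.lt_or_gt with htT | htT
      · have l1 := B.discSq_lt_of_lt_slope h1.ne h2.ne' s21 htT
        have l2 := B.discSq_lt_of_lt_slope h2.ne' h0.ne s02 htT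
        refine slice_of_notMem_of_notMem (fun hh => by linarith [hh.1])
          (fun hh => by linarith [hh.1]) ?_
        ext ζ
        simp only [Set.mem_ofPred_eq, Set.mem_empty_iff_false, iff_false]
        rintro ⟨h | h, h'⟩ <;> linarith
      · have l1 := B.discSq_lt_of_slope_lt h2.ne' h1.ne s21 htT
        have l2 := B.discSq_lt_of_slope_lt h0.ne h1.ne (s02.trans s21) htT
        rw [a1 htT, indicator_discSq_above (B.antipode_lt_circleHeight h0) htT]
        refine ⟨by linarith [max_le_max_right 0 l2.le], ?_⟩
        rw [show ∀ x y : ℝ, Real.pi * (x + -1 * y) = Real.pi * x - Real.pi * y by intros; ring,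
          ← volume_annulus l2.le]
        congr 1
        ext ζ
        simp only [Set.mem_ofPred_eq]
        constructor
        · rintro ⟨h | h, h'⟩
          · exact ⟨h', h⟩
          · exact ⟨h', h.trans l1⟩
        · rintro ⟨h, h'⟩
          exact ⟨Or.inl h', h⟩
  -- The inner cap is a Euclidean disc; with `ε = 0` the second profile is a dummy.
  · have e0 := B.circleHeight_eq_of_zero h0
    rw [e0, intervalIntegral.integral_same,
      hypVolume_eq_of_slice B.measurableSet_upperRegion c1 c1 hT hT1.le hT hT1.le
        (T := B.circleHeight) (ε := 0)]
    · congr 1; ring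
    · intro t ht htT
      rw [B.slice_upperRegion_of_zero h0 ht]
      rcases htT.lt_or_gt with htT | htT
      · refine slice_of_notMem_of_notMem (fun hh => by linarith [hh.1])
          (fun hh => by linarith [hh.1]) ?_
        ext ζ
        simp only [Set.mem_ofPred_eq, Set.mem_empty_iff_false, iff_false]
        rintro ⟨_, h'⟩
        linarith
      · have l1 := B.discSq_lt_of_slope_lt h2.ne' h1.ne s21 htT
        rw [a1 htT, zero_mul, add_zero]
        refine ⟨le_max_right _ _, ?_⟩
        rw [← volume_norm_sq_lt_max]
        congr 1
        ext ζ
        simp only [Set.mem_ofPred_eq, htT, and_true]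
        exact ⟨fun h => h.elim id fun h => h.trans l1, Or.inl⟩
  -- The inner cap bulges downwards: the slices are those of ball `0` below the circle and of ball
  -- `1` above it.
  · have hT0 := B.h_lt_circleHeight h0
    have s10 := B.slope_one_lt_zero h0
    rw [hypVolume_eq_of_slice B.measurableSet_upperRegion c0 c1 (B.h_pos 0) hT0.le hT hT1.le
        (T := B.circleHeight) (ε := 1)]
    · congr 1; ring
    · intro t ht htT
      rw [B.slice_upperRegion_of_pos h0 ht, one_mul]
      rcases htT.lt_or_gt with htT | htT
      · have l1 := B.discSq_lt_of_lt_slope h0.ne' h2.ne' (s21.trans s10) htT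
        rw [indicator_discSq_below (B.circleHeight_lt_antipode h0) htT,
          Set.indicator_of_notMem (fun hh => by linarith [hh.1]), add_zero]
        refine ⟨le_max_right _ _, ?_⟩
        rw [← volume_norm_sq_lt_max]
        congr 1
        ext ζ
        simp only [Set.mem_ofPred_eq]
        exact ⟨fun h => h.2, fun h => ⟨Or.inr (h.trans l1), h⟩⟩
      · have l1 := B.discSq_lt_of_slope_lt h2.ne' h1.ne s21 htT
        have l2 := B.discSq_lt_of_slope_lt h1.ne h0.ne' s10 htT
        rw [a1 htT, Set.indicator_of_notMem (fun hh => by linarith [hh.2]), zero_add]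
        refine ⟨le_max_right _ _, ?_⟩
        rw [← volume_norm_sq_lt_max]
        congr 1
        ext ζ
        simp only [Set.mem_ofPred_eq]
        exact ⟨fun h => h.1.elim id fun h => h.trans l1, fun h => ⟨Or.inl h, h.trans l2⟩⟩

theorem hypVolume_lowerRegion : hypVolume B.lowerRegion = ENNReal.ofReal
    (capVolume (B.h 2) (B.κ 2) B.circleHeight - capVolume (B.h 0) (B.κ 0) B.circleHeight) := by
  have hT := B.circleHeight_pos
  have h1 := B.upper_neg
  have h2 := B.lower_sphere
  have hT2 := B.h_lt_circleHeight h2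
  have s21 := B.slope_two_lt_one
  have a2 := fun {t} => indicator_discSq_below (t := t) (B.circleHeight_lt_antipode h2)
  have c2 := continuous_discSq (B.h 2) (B.κ 2)
  have c0 := continuous_discSq (B.h 0) (B.κ 0)
  rw [capVolume, capVolume]
  rcases lt_trichotomy (B.κ 0) 0 with h0 | h0 | h0
  · have hT0 := B.circleHeight_lt_h h0
    have s02 := B.slope_zero_lt_two h0
    rw [intervalIntegral.integral_symm B.circleHeight (B.h 0),
      hypVolume_eq_of_slice B.measurableSet_lowerRegion c2 c0 (B.h_pos 2) hT2.le hT hT0.le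
        (T := B.circleHeight) (ε := 1)]
    · congr 1; ring
    · intro t ht htT
      rw [B.slice_lowerRegion_of_neg h0 ht, one_mul]
      rcases htT.lt_or_gt with htT | htT
      · have l1 := B.discSq_lt_of_lt_slope h1.ne h2.ne' s21 htT
        have l2 := B.discSq_lt_of_lt_slope h2.ne' h0.ne s02 htT
        rw [a2 htT, Set.indicator_of_notMem (fun hh => by linarith [hh.1]), add_zero]
        refine ⟨le_max_right _ _, ?_⟩
        rw [← volume_norm_sq_lt_max]
        congr 1
        ext ζ
        simp only [Set.mem_ofPred_eq]
        exact ⟨fun h => h.1.elim (fun h => h.trans l1) id, fun h => ⟨Or.inr h, h.trans l2⟩⟩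
      · have l2 := B.discSq_lt_of_slope_lt h0.ne h1.ne (s02.trans s21) htT
        rw [indicator_discSq_above (B.antipode_lt_circleHeight h0) htT,
          Set.indicator_of_notMem (fun hh => by linarith [hh.2]), zero_add]
        refine ⟨le_max_right _ _, ?_⟩
        rw [← volume_norm_sq_lt_max]
        congr 1
        ext ζ
        simp only [Set.mem_ofPred_eq]
        exact ⟨fun h => h.2, fun h => ⟨Or.inl (h.trans l2), h⟩⟩
  · have e0 := B.circleHeight_eq_of_zero h0
    rw [e0, intervalIntegral.integral_same,
      hypVolume_eq_of_slice B.measurableSet_lowerRegion c2 c2 (B.h_pos 2) hT2.le (B.h_pos 2) hT2.le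
        (T := B.circleHeight) (ε := 0)]
    · congr 1; ring
    · intro t ht htT
      rw [B.slice_lowerRegion_of_zero h0 ht]
      rcases htT.lt_or_gt with htT | htT
      · have l1 := B.discSq_lt_of_lt_slope h1.ne h2.ne' s21 htT
        rw [a2 htT, zero_mul, add_zero]
        refine ⟨le_max_right _ _, ?_⟩
        rw [← volume_norm_sq_lt_max]
        congr 1
        ext ζ
        simp only [Set.mem_ofPred_eq, htT, and_true]
        exact ⟨fun h => h.elim (fun h => h.trans l1) id, Or.inr⟩
      · refine slice_of_notMem_of_notMem (fun hh => by linarith [hh.2])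
          (fun hh => by linarith [hh.2]) ?_
        ext ζ
        simp only [Set.mem_ofPred_eq, Set.mem_empty_iff_false, iff_false]
        rintro ⟨_, h'⟩
        linarith
  · have hT0 := B.h_lt_circleHeight h0
    have s10 := B.slope_one_lt_zero h0
    rw [hypVolume_eq_of_slice B.measurableSet_lowerRegion c2 c0 (B.h_pos 2) hT2.le (B.h_pos 0)
        hT0.le (T := B.circleHeight) (ε := -1)]
    · congr 1; ring
    · intro t ht htT
      rw [B.slice_lowerRegion_of_pos h0 ht]
      rcases htT.lt_or_gt with htT | htT
      · have l1 := B.discSq_lt_of_lt_slope h1.ne h2.ne' s21 htT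
        have l2 := B.discSq_lt_of_lt_slope h0.ne' h2.ne' (s21.trans s10) htT
        rw [a2 htT, indicator_discSq_below (B.circleHeight_lt_antipode h0) htT]
        refine ⟨by linarith [max_le_max_right 0 l2.le], ?_⟩
        rw [show ∀ x y : ℝ, Real.pi * (x + -1 * y) = Real.pi * x - Real.pi * y by intros; ring,
          ← volume_annulus l2.le]
        congr 1
        ext ζ
        simp only [Set.mem_ofPred_eq]
        constructor
        · rintro ⟨h | h, h'⟩
          · exact ⟨h', h.trans l1⟩
          · exact ⟨h', h⟩
        · rintro ⟨h, h'⟩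
          exact ⟨Or.inr h', h⟩
      · have l1 := B.discSq_lt_of_slope_lt h2.ne' h1.ne s21 htT
        have l2 := B.discSq_lt_of_slope_lt h1.ne h0.ne' s10 htT
        refine slice_of_notMem_of_notMem (fun hh => by linarith [hh.2])
          (fun hh => by linarith [hh.2]) ?_
        ext ζ
        simp only [Set.mem_ofPred_eq, Set.mem_empty_iff_false, iff_false]
        rintro ⟨h | h, h'⟩ <;> linarith

/-- The upper region lies in the ball that carries the upper outer cap, up to the height of the
common circle, which is a null set. -/
lemma upperRegion_subset : B.upperRegion ⊆
    belowSide (B.h 1) (B.κ 1) ∪ {p | p.2 = B.circleHeight} := by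
  intro p hp
  have ht : 0 < p.2 := hp.2.1
  have h1 := B.upper_neg
  have h2 := B.lower_sphere
  have s21 := B.slope_two_lt_one
  by_cases hT : p.2 = B.circleHeight
  · exact Or.inr hT
  left
  refine ⟨ht, (sideFun_pos_iff_of_neg h1 p).2 ?_⟩
  have he := (B.mem_enclosed_iff ht).1 hp.1
  have hs : sideFun (B.h 0) (B.κ 0) p < 0 := hp.2.2
  rcases lt_or_gt_of_ne hT with hT | hT
  · rcases lt_trichotomy (B.κ 0) 0 with h0 | h0 | h0
    · have h3 := (sideFun_neg_iff_of_neg h0 p).1 hs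
      have l1 := B.discSq_lt_of_lt_slope h1.ne h2.ne' s21 hT
      have l2 := B.discSq_lt_of_lt_slope h2.ne' h0.ne (B.slope_zero_lt_two h0) hT
      rcases he with he | he <;> linarith
    · simp only [sideFun, h0, B.circleHeight_eq_of_zero h0] at hs
      linarith
    · exact ((sideFun_neg_iff_of_pos h0 p).1 hs).trans
        (B.discSq_lt_of_lt_slope h0.ne' h1.ne (B.slope_one_lt_zero h0) hT)
  · exact he.elim id fun h => h.trans (B.discSq_lt_of_slope_lt h2.ne' h1.ne s21 hT)

end StandardDoubleBubble

/-! ### Double bubbles in terms of the mean curvatures of the outer caps -/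

/-- The number and its companion with `-H` for `H` have positive product and positive sum. -/
lemma capNum_pos {s H E : ℝ} (hrel : s ^ 2 * (H ^ 2 + E ^ 2 - 1) = 1) (hD : 0 < 1 + s * E) :
    0 < 1 + s * E + s ^ 2 * (1 - H) := by
  have h1 : (1 + s * E + s ^ 2 * (1 - H)) * (1 + s * E + s ^ 2 * (1 + H)) =
      (1 + s ^ 2) * (1 + s * E) ^ 2 := by linear_combination (-s ^ 2) * hrel
  by_contra hc
  push Not at hc
  have h2 : 0 ≤ 1 + s * E + s ^ 2 * (1 + H) := by nlinarith [sq_nonneg s]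
  have h3 : 0 < (1 + s ^ 2) * (1 + s * E) ^ 2 := by positivity
  nlinarith

/-- The hypothesis on `s` is the relation `hrel` differentiated. The point is the shape of the
result: apart from a multiple of `H'`, it involves only `H' E - E' H` and `H H' + E E'`, a
determinant and an inner product. These are invariant under rotation of `(H, E)`, hence the same for
all three caps, and cancel in differences. -/
lemma hasDerivAt_capNum_log {s H E : ℝ → ℝ} {H' E' t : ℝ}
    (hs : HasDerivAt s (-s t ^ 3 * (H t * H' + E t * E')) t) (hH : HasDerivAt H H' t)
    (hE : HasDerivAt E E' t) (hrel : s t ^ 2 * (H t ^ 2 + E t ^ 2 - 1) = 1)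
    (hD : 0 < 1 + s t * E t) :
    HasDerivAt (fun x => Real.log ((1 + s x * E x + s x ^ 2 * (1 - H x)) / (1 + s x * E x)) +
        H x * s x ^ 2 / (1 + s x * E x))
      (-(s t ^ 4 * ((1 + s t * E t + 1) / (1 + s t * E t) ^ 2)) * H' +
        (s t ^ 5 * (H' * E t - E' * H t) - s t ^ 4 * (H t * H' + E t * E')) / (1 + s t ^ 2)) t := by
  have hN := capNum_pos hrel hD
  have dD : HasDerivAt (fun x => 1 + s x * E x) _ t := (hs.mul hE).const_add 1
  have dN : HasDerivAt (fun x => 1 + s x * E x + s x ^ 2 * (1 - H x)) _ t :=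
    dD.add ((hs.pow 2).mul (hH.const_sub 1))
  have dG : HasDerivAt (fun x => H x * s x ^ 2 / (1 + s x * E x)) _ t :=
    (hH.mul (hs.pow 2)).div dD hD.ne'
  refine (((dN.div dD hD.ne').log (div_pos hN hD).ne').add dG).congr_deriv ?_
  have h1 : (1 + s t * E t + s t ^ 2 * (1 - H t)) * (1 + s t * E t + s t ^ 2 * (1 + H t)) =
      (1 + s t ^ 2) * (1 + s t * E t) ^ 2 := by linear_combination (-s t ^ 2) * hrel
  simp only [Pi.pow_apply, Pi.mul_apply, Pi.div_apply]
  generalize s t = s at *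
  generalize H t = H at *
  generalize E t = E at *
  have hM : 0 < 1 + s * E + s ^ 2 * (1 + H) := by
    have h3 : 0 < (1 + s ^ 2) * (1 + s * E) ^ 2 := by positivity
    rw [← h1] at h3
    exact pos_of_mul_pos_right h3 hN.le
  have hN' : (1 + s * E + s ^ 2 * (1 - H)) =
      (1 + s ^ 2) * (1 + s * E) ^ 2 / (1 + s * E + s ^ 2 * (1 + H)) := by
    rw [← h1]; field_simp
  have hq : 0 < 1 + s ^ 2 := by positivity
  -- The factorisation `h1` trades the numerator of the logarithm for its companion, leaving only `1
  -- + sE` and `1 + s²` in denominators.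
  have key : ∀ n' d' : ℝ, (n' * (1 + s * E) - (1 + s * E + s ^ 2 * (1 - H)) * d') /
      (1 + s * E) ^ 2 / ((1 + s * E + s ^ 2 * (1 - H)) / (1 + s * E)) =
      n' * (1 + s * E + s ^ 2 * (1 + H)) / ((1 + s ^ 2) * (1 + s * E) ^ 2) - d' / (1 + s * E) := by
    intro n' d'
    rw [← h1]
    have := hN.ne'
    have := hM.ne'
    generalize 1 + s * E + s ^ 2 * (1 - H) = N at *
    generalize 1 + s * E + s ^ 2 * (1 + H) = M at *
    field_simp
  rw [key]
  clear key hN' h1 hN hM dD dN dG hs hH hE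
  have := hD.ne'
  have := hq.ne'
  push_cast
  field_simp
  linear_combination
    (2 * s ^ 4 * H * H' + 2 * s ^ 4 * E * E' - s ^ 5 * E * H' - 2 * s ^ 4 * H') * hrel

/-- This is `H` times the leading and rotational parts of the derivative in `hasDerivAt_capNum_log`,
plus a multiple of `E`. After summation over the caps, `∑ H = 0` and `∑ E = 0` turn it into the
first variation formula. -/
lemma hasDerivAt_capSize {s H E : ℝ → ℝ} {H' E' t : ℝ}
    (hs : HasDerivAt s (-s t ^ 3 * (H t * H' + E t * E')) t)
    (hE : HasDerivAt E E' t) (hrel : s t ^ 2 * (H t ^ 2 + E t ^ 2 - 1) = 1)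
    (hD : 0 < 1 + s t * E t) :
    HasDerivAt (fun x => s x ^ 2 / (1 + s x * E x))
      (H t * (-(s t ^ 4 * ((1 + s t * E t + 1) / (1 + s t * E t) ^ 2)) * H' +
        (s t ^ 5 * (H' * E t - E' * H t)) / (1 + s t ^ 2)) -
        s t ^ 5 * (H t * H' + E t * E') * E t / (1 + s t ^ 2)) t := by
  have dD : HasDerivAt (fun x => 1 + s x * E x) _ t := (hs.mul hE).const_add 1
  refine ((hs.pow 2).div dD hD.ne').congr_deriv ?_
  simp only [Pi.pow_apply]
  generalize s t = s at *
  generalize H t = H at *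
  generalize E t = E at *
  have hq : 0 < 1 + s ^ 2 := by positivity
  have := hD.ne'
  have := hq.ne'
  push_cast
  field_simp
  linear_combination (s ^ 3 * E' + 2 * s ^ 4 * E * E' + s ^ 5 * E ^ 2 * E') * hrel

/-- The mean curvatures of the three caps of a double bubble, from those of the two outer caps. -/
def capH : Fin 3 → ℝ × ℝ →L[ℝ] ℝ :=
  ![ContinuousLinearMap.fst ℝ ℝ ℝ - ContinuousLinearMap.snd ℝ ℝ ℝ,
    -ContinuousLinearMap.fst ℝ ℝ ℝ, ContinuousLinearMap.snd ℝ ℝ ℝ]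

/-- The companions of the mean curvatures: `capH i` and `capE i` are the coordinates of a point of
the plane in three frames that are rotated by `120°`. -/
noncomputable def capE : Fin 3 → ℝ × ℝ →L[ℝ] ℝ :=
  ![(√3)⁻¹ • (capH 2 - capH 1), (√3)⁻¹ • (capH 0 - capH 2), (√3)⁻¹ • (capH 1 - capH 0)]

/-- Ratio of Euclidean radius and height of the common circle. -/
noncomputable def circleRatio (u : ℝ × ℝ) : ℝ :=
  (√(4 / 3 * (u.1 ^ 2 + u.2 ^ 2 - u.1 * u.2) - 1))⁻¹

/-- Signed volume of a cap divided by `π`, up to a common summand. -/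
noncomputable def capW (i : Fin 3) (u : ℝ × ℝ) : ℝ :=
  Real.log ((1 + circleRatio u * capE i u + circleRatio u ^ 2 * (1 - capH i u)) /
    (1 + circleRatio u * capE i u)) + capH i u * circleRatio u ^ 2 / (1 + circleRatio u * capE i u)

/-- Area of a cap divided by `2 π`. -/
noncomputable def capA (i : Fin 3) (u : ℝ × ℝ) : ℝ :=
  circleRatio u ^ 2 / (1 + circleRatio u * capE i u)

/-- The set of pairs of admissible mean curvatures. -/
def quadrant : Set (ℝ × ℝ) := Set.Ioi 1 ×ˢ Set.Ioi 1

@[simp] lemma capH_zero (u : ℝ × ℝ) : capH 0 u = u.1 - u.2 := rfl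
@[simp] lemma capH_one (u : ℝ × ℝ) : capH 1 u = -u.1 := rfl
@[simp] lemma capH_two (u : ℝ × ℝ) : capH 2 u = u.2 := rfl
@[simp] lemma capE_zero (u : ℝ × ℝ) : capE 0 u = (√3)⁻¹ * (u.1 + u.2) := by
  simp [capE]; ring
@[simp] lemma capE_one (u : ℝ × ℝ) : capE 1 u = (√3)⁻¹ * (u.1 - 2 * u.2) := by
  simp [capE]; ring
@[simp] lemma capE_two (u : ℝ × ℝ) : capE 2 u = (√3)⁻¹ * (u.2 - 2 * u.1) := by
  simp [capE]; ring

lemma inv_sqrt_three_sq : (√3)⁻¹ ^ 2 = (1 / 3 : ℝ) := by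
  rw [inv_pow, Real.sq_sqrt (by norm_num)]; norm_num

lemma capH_sq_add_capE_sq (i : Fin 3) (u : ℝ × ℝ) :
    capH i u ^ 2 + capE i u ^ 2 = 4 / 3 * (u.1 ^ 2 + u.2 ^ 2 - u.1 * u.2) := by
  have h := inv_sqrt_three_sq
  fin_cases i <;> simp only [Fin.zero_eta, Fin.mk_one, Fin.reduceFinMk, capH_zero, capE_zero,
    capH_one, capE_one, capH_two, capE_two, mul_pow, h] <;> ring

lemma capH_mul_add_capE_mul (i : Fin 3) (u ξ : ℝ × ℝ) :
    capH i u * capH i ξ + capE i u * capE i ξ =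
      2 / 3 * (2 * u.1 * ξ.1 + 2 * u.2 * ξ.2 - u.1 * ξ.2 - u.2 * ξ.1) := by
  have h := inv_sqrt_three_sq
  fin_cases i <;> simp only [Fin.zero_eta, Fin.mk_one, Fin.reduceFinMk, capH_zero, capE_zero,
    capH_one, capE_one, capH_two, capE_two] <;> generalize (√3)⁻¹ = a at *
  · linear_combination (u.1 + u.2) * (ξ.1 + ξ.2) * h
  · linear_combination (u.1 - 2 * u.2) * (ξ.1 - 2 * ξ.2) * h
  · linear_combination (u.2 - 2 * u.1) * (ξ.2 - 2 * ξ.1) * h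

lemma capH_mul_sub_capE_mul (i : Fin 3) (u ξ : ℝ × ℝ) :
    capH i ξ * capE i u - capE i ξ * capH i u = 2 * (√3)⁻¹ * (u.2 * ξ.1 - u.1 * ξ.2) := by
  fin_cases i <;> simp only [Fin.zero_eta, Fin.mk_one, Fin.reduceFinMk, capH_zero, capE_zero,
    capH_one, capE_one, capH_two, capE_two] <;> ring

lemma one_lt_of_mem_quadrant {u : ℝ × ℝ} (hu : u ∈ quadrant) :
    1 / 3 < 4 / 3 * (u.1 ^ 2 + u.2 ^ 2 - u.1 * u.2) - 1 := by
  have h1 : 1 < u.1 := hu.1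
  have h2 : 1 < u.2 := hu.2
  nlinarith [sq_nonneg (u.1 - u.2), mul_pos (sub_pos.2 h1) (sub_pos.2 h2)]

lemma circleRatio_pos {u : ℝ × ℝ} (hu : u ∈ quadrant) : 0 < circleRatio u := by
  have := one_lt_of_mem_quadrant hu
  exact inv_pos.2 (Real.sqrt_pos.2 (by linarith))

lemma circleRatio_sq {u : ℝ × ℝ} (hu : u ∈ quadrant) :
    circleRatio u ^ 2 = (4 / 3 * (u.1 ^ 2 + u.2 ^ 2 - u.1 * u.2) - 1)⁻¹ := by
  have := one_lt_of_mem_quadrant hu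
  rw [circleRatio, inv_pow, Real.sq_sqrt (by linarith)]

lemma circleRatio_rel {u : ℝ × ℝ} (hu : u ∈ quadrant) (i : Fin 3) :
    circleRatio u ^ 2 * (capH i u ^ 2 + capE i u ^ 2 - 1) = 1 := by
  have := one_lt_of_mem_quadrant hu
  rw [capH_sq_add_capE_sq, circleRatio_sq hu, inv_mul_cancel₀ (by linarith)]

lemma circleRatio_sq_lt {u : ℝ × ℝ} (hu : u ∈ quadrant) : circleRatio u ^ 2 < 3 := by
  have := one_lt_of_mem_quadrant hu
  rw [circleRatio_sq hu, inv_lt_comm₀ (by linarith) (by norm_num)]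
  linarith

/-- For an outer cap, `|H| > 1` and the relation `s² (H² + E² - 1) = 1` force `|sE| < 1`. For the
inner cap `E` itself is positive. -/
lemma capD_pos {u : ℝ × ℝ} (hu : u ∈ quadrant) (i : Fin 3) : 0 < 1 + circleRatio u * capE i u := by
  have hs := circleRatio_pos hu
  have h1 : 1 < u.1 := hu.1
  have h2 : 1 < u.2 := hu.2
  have hr := circleRatio_rel hu i
  have key : 1 < capH i u ^ 2 → 0 < 1 + circleRatio u * capE i u := by
    intro h
    have : (circleRatio u * capE i u) ^ 2 < 1 ^ 2 := by nlinarith [sq_nonneg (circleRatio u)]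
    linarith [(abs_lt_of_sq_lt_sq' this (by norm_num)).1]
  fin_cases i
  · have h3 : 0 < (√3)⁻¹ := by positivity
    simp only [Fin.zero_eta, capE_zero]
    have : 0 < u.1 + u.2 := by linarith
    positivity
  · apply key
    simp only [Fin.mk_one, capH_one]
    nlinarith
  · apply key
    simp only [Fin.reduceFinMk, capH_two]
    nlinarith

lemma isOpen_quadrant : IsOpen quadrant := isOpen_Ioi.prod isOpen_Ioi

lemma convex_quadrant : Convex ℝ quadrant := (convex_Ioi 1).prod (convex_Ioi 1)

lemma contDiffAt_circleRatio {u : ℝ × ℝ} (hu : u ∈ quadrant) : ContDiffAt ℝ 1 circleRatio u := by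
  have h := one_lt_of_mem_quadrant hu
  have h1 : ContDiffAt ℝ 1 (fun u : ℝ × ℝ => 4 / 3 * (u.1 ^ 2 + u.2 ^ 2 - u.1 * u.2) - 1) u := by
    fun_prop
  exact (h1.sqrt (by linarith)).inv (Real.sqrt_pos.2 (by linarith)).ne'

lemma contDiffAt_capA {u : ℝ × ℝ} (hu : u ∈ quadrant) (i : Fin 3) : ContDiffAt ℝ 1 (capA i) u := by
  have h := contDiffAt_circleRatio hu
  exact (h.pow 2).div (contDiffAt_const.add (h.mul (capE i).contDiff.contDiffAt)) (capD_pos hu i).ne'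

lemma contDiffAt_capW {u : ℝ × ℝ} (hu : u ∈ quadrant) (i : Fin 3) : ContDiffAt ℝ 1 (capW i) u := by
  have h := contDiffAt_circleRatio hu
  have hD := capD_pos hu i
  have hN := capNum_pos (circleRatio_rel hu i) hD
  have dD : ContDiffAt ℝ 1 (fun u => 1 + circleRatio u * capE i u) u :=
    contDiffAt_const.add (h.mul (capE i).contDiff.contDiffAt)
  have dN : ContDiffAt ℝ 1
      (fun u => 1 + circleRatio u * capE i u + circleRatio u ^ 2 * (1 - capH i u)) u :=
    dD.add ((h.pow 2).mul (contDiffAt_const.sub (capH i).contDiff.contDiffAt))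
  exact ((dN.div dD hD.ne').log (div_pos hN hD).ne').add
    (((capH i).contDiff.contDiffAt.mul (h.pow 2)).div dD hD.ne')

/-! ### Derivatives of volumes and area along curves of curvatures -/

lemma hasDerivAt_circleRatio {γ : ℝ → ℝ × ℝ} {ξ : ℝ × ℝ} {t : ℝ} (hγ : HasDerivAt γ ξ t)
    (ht : γ t ∈ quadrant) (i : Fin 3) :
    HasDerivAt (fun x => circleRatio (γ x)) (-circleRatio (γ t) ^ 3 *
      (capH i (γ t) * capH i ξ + capE i (γ t) * capE i ξ)) t := by
  have h := one_lt_of_mem_quadrant ht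
  have h1 : HasDerivAt (fun x => (γ x).1) ξ.1 t := hγ.fst
  have h2 : HasDerivAt (fun x => (γ x).2) ξ.2 t := hγ.snd
  have hq := (((((h1.pow 2).add (h2.pow 2)).sub (h1.mul h2)).const_mul (4 / 3)).sub_const 1)
  have hs : 0 < √(4 / 3 * ((γ t).1 ^ 2 + (γ t).2 ^ 2 - (γ t).1 * (γ t).2) - 1) :=
    Real.sqrt_pos.2 (by linarith)
  refine ((hq.sqrt (by simpa using by linarith)).inv (by simpa using hs.ne')).congr_deriv ?_
  rw [capH_mul_add_capE_mul, circleRatio]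
  simp only [Pi.add_apply, Pi.sub_apply, Pi.mul_apply, Pi.pow_apply]
  field_simp
  push_cast
  ring

/-- The weight of a cap in the derivative of the volumes. -/
noncomputable def capK (i : Fin 3) (u : ℝ × ℝ) : ℝ :=
  circleRatio u ^ 4 * ((1 + circleRatio u * capE i u + 1) / (1 + circleRatio u * capE i u) ^ 2)

lemma capK_pos {u : ℝ × ℝ} (hu : u ∈ quadrant) (i : Fin 3) : 0 < capK i u := by
  have := circleRatio_pos hu
  have := capD_pos hu i
  unfold capK
  positivity

/-- Together with `radTerm`, the part of the derivative of `capW i` that does not depend on the cap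
`i`. -/
noncomputable def rotTerm (u ξ : ℝ × ℝ) : ℝ :=
  circleRatio u ^ 5 * (2 * (√3)⁻¹ * (u.2 * ξ.1 - u.1 * ξ.2)) / (1 + circleRatio u ^ 2)

noncomputable def radTerm (u ξ : ℝ × ℝ) : ℝ :=
  circleRatio u ^ 4 * (2 / 3 * (2 * u.1 * ξ.1 + 2 * u.2 * ξ.2 - u.1 * ξ.2 - u.2 * ξ.1)) /
    (1 + circleRatio u ^ 2)

lemma hasDerivAt_capW {γ : ℝ → ℝ × ℝ} {ξ : ℝ × ℝ} {t : ℝ} (hγ : HasDerivAt γ ξ t)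
    (ht : γ t ∈ quadrant) (i : Fin 3) :
    HasDerivAt (fun x => capW i (γ x))
      (-capK i (γ t) * capH i ξ + (rotTerm (γ t) ξ - radTerm (γ t) ξ)) t := by
  have hH : HasDerivAt (fun x => capH i (γ x)) (capH i ξ) t :=
    (capH i).hasFDerivAt.comp_hasDerivAt t hγ
  have hE : HasDerivAt (fun x => capE i (γ x)) (capE i ξ) t :=
    (capE i).hasFDerivAt.comp_hasDerivAt t hγ
  refine (hasDerivAt_capNum_log (hasDerivAt_circleRatio hγ ht i) hH hE (circleRatio_rel ht i)
    (capD_pos ht i)).congr_deriv ?_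
  rw [capH_mul_sub_capE_mul, capH_mul_add_capE_mul, capK, rotTerm, radTerm]
  ring

lemma hasDerivAt_capA {γ : ℝ → ℝ × ℝ} {ξ : ℝ × ℝ} {t : ℝ} (hγ : HasDerivAt γ ξ t)
    (ht : γ t ∈ quadrant) (i : Fin 3) :
    HasDerivAt (fun x => capA i (γ x))
      (capH i (γ t) * (-capK i (γ t) * capH i ξ + rotTerm (γ t) ξ) -
        circleRatio (γ t) * radTerm (γ t) ξ * capE i (γ t)) t := by
  have hE : HasDerivAt (fun x => capE i (γ x)) (capE i ξ) t :=
    (capE i).hasFDerivAt.comp_hasDerivAt t hγ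
  refine (hasDerivAt_capSize (H := fun x => capH i (γ x)) (hasDerivAt_circleRatio hγ ht i) hE
    (circleRatio_rel ht i) (capD_pos ht i)).congr_deriv ?_
  rw [capH_mul_sub_capE_mul, capH_mul_add_capE_mul, capK, rotTerm, radTerm]
  ring

/-- The volumes of the upper and the lower region of the double bubble whose outer caps have mean
curvatures `u`. -/
noncomputable def bubbleVol (u : ℝ × ℝ) : ℝ × ℝ :=
  (Real.pi * (capW 0 u - capW 1 u), Real.pi * (capW 2 u - capW 0 u))

/-- The area of the double bubble whose outer caps have mean curvatures `u`. -/
noncomputable def bubbleArea (u : ℝ × ℝ) : ℝ :=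
  2 * Real.pi * (capA 0 u + capA 1 u + capA 2 u)

lemma contDiffAt_bubbleVol {u : ℝ × ℝ} (hu : u ∈ quadrant) : ContDiffAt ℝ 1 bubbleVol u :=
  (contDiffAt_const.mul ((contDiffAt_capW hu 0).sub (contDiffAt_capW hu 1))).prodMk
    (contDiffAt_const.mul ((contDiffAt_capW hu 2).sub (contDiffAt_capW hu 0)))

lemma contDiffAt_bubbleArea {u : ℝ × ℝ} (hu : u ∈ quadrant) : ContDiffAt ℝ 1 bubbleArea u :=
  contDiffAt_const.mul (((contDiffAt_capA hu 0).add (contDiffAt_capA hu 1)).add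
    (contDiffAt_capA hu 2))

/-- The derivative of the volumes in the direction `ξ`. -/
noncomputable def bubbleVolDeriv (u ξ : ℝ × ℝ) : ℝ × ℝ :=
  (Real.pi * (-capK 0 u * capH 0 ξ + capK 1 u * capH 1 ξ),
    Real.pi * (-capK 2 u * capH 2 ξ + capK 0 u * capH 0 ξ))

lemma hasDerivAt_bubbleVol {γ : ℝ → ℝ × ℝ} {ξ : ℝ × ℝ} {t : ℝ} (hγ : HasDerivAt γ ξ t)
    (ht : γ t ∈ quadrant) :
    HasDerivAt (fun x => bubbleVol (γ x)) (bubbleVolDeriv (γ t) ξ) t := by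
  have h0 := hasDerivAt_capW hγ ht 0
  have h1 := hasDerivAt_capW hγ ht 1
  have h2 := hasDerivAt_capW hγ ht 2
  refine (((h0.sub h1).const_mul Real.pi).prodMk ((h2.sub h0).const_mul Real.pi)).congr_deriv ?_
  unfold bubbleVolDeriv
  congr 1 <;> ring

/-- The common terms have cancelled, and what is left is minus a weighted sum of the squares of the
three `capH i ξ`, with positive weights `capK i`. -/
lemma bubbleVolDeriv_inner_neg {u ξ : ℝ × ℝ} (hu : u ∈ quadrant) (hξ : ξ ≠ 0) :
    (bubbleVolDeriv u ξ).1 * ξ.1 + (bubbleVolDeriv u ξ).2 * ξ.2 < 0 := by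
  have h0 := capK_pos hu 0
  have h1 := capK_pos hu 1
  have h2 := capK_pos hu 2
  have e : (bubbleVolDeriv u ξ).1 * ξ.1 + (bubbleVolDeriv u ξ).2 * ξ.2 = -(Real.pi *
      (capK 0 u * (ξ.1 - ξ.2) ^ 2 + capK 1 u * ξ.1 ^ 2 + capK 2 u * ξ.2 ^ 2)) := by
    simp only [bubbleVolDeriv, capH_zero, capH_one, capH_two]
    ring
  rw [e, neg_lt_zero]
  apply mul_pos Real.pi_pos
  by_cases hx : ξ.1 = 0
  · have hy : ξ.2 ≠ 0 := fun hy => hξ (Prod.ext hx hy)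
    positivity
  · positivity

/-- First variation: the derivative of the area is the sum of the derivatives of the volumes,
weighted by twice the mean curvatures. -/
lemma hasDerivAt_bubbleArea {γ : ℝ → ℝ × ℝ} {ξ : ℝ × ℝ} {t : ℝ} (hγ : HasDerivAt γ ξ t)
    (ht : γ t ∈ quadrant) :
    HasDerivAt (fun x => bubbleArea (γ x)) (2 * (γ t).1 * (bubbleVolDeriv (γ t) ξ).1 +
      2 * (γ t).2 * (bubbleVolDeriv (γ t) ξ).2) t := by
  have h0 := hasDerivAt_capA hγ ht 0
  have h1 := hasDerivAt_capA hγ ht 1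
  have h2 := hasDerivAt_capA hγ ht 2
  refine (((h0.add h1).add h2).const_mul (2 * Real.pi)).congr_deriv ?_
  simp only [bubbleVolDeriv, capH_zero, capH_one, capH_two, capE_zero, capE_one, capE_two]
  ring

lemma fderiv_bubbleVol {u : ℝ × ℝ} (hu : u ∈ quadrant) (ξ : ℝ × ℝ) :
    fderiv ℝ bubbleVol u ξ = bubbleVolDeriv u ξ := by
  have hγ : HasDerivAt (fun t : ℝ => u + t • ξ) ξ 0 := by
    simpa using ((hasDerivAt_id (0 : ℝ)).smul_const ξ).const_add u
  have h0 : u + (0 : ℝ) • ξ = u := by simp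
  have h1 := hasDerivAt_bubbleVol hγ (by rwa [h0])
  have hd : HasFDerivAt bubbleVol (fderiv ℝ bubbleVol u) (u + (0 : ℝ) • ξ) := by
    rw [h0]; exact ((contDiffAt_bubbleVol hu).differentiableAt one_ne_zero).hasFDerivAt
  have h2 := hd.comp_hasDerivAt (0 : ℝ) hγ
  have := h2.unique h1
  rwa [h0] at this

/-- A map with negative definite derivative on a convex set is injective: on the segment between two
points with equal image, Rolle's theorem applies to the inner product of the map with the direction
of the segment. -/
lemma injOn_bubbleVol : Set.InjOn bubbleVol quadrant := by
  intro u hu u' hu' h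
  by_contra hne
  set ξ := u' - u with hξ
  have hξ0 : ξ ≠ 0 := sub_ne_zero.2 (Ne.symm hne)
  have hγ : ∀ t : ℝ, HasDerivAt (fun t : ℝ => u + t • ξ) ξ t := fun t => by
    simpa using ((hasDerivAt_id t).smul_const ξ).const_add u
  have hmem : ∀ t ∈ Set.Icc (0 : ℝ) 1, u + t • ξ ∈ quadrant := fun t ht =>
    convex_quadrant.add_smul_sub_mem hu hu' ht
  have hder : ∀ t ∈ Set.Icc (0 : ℝ) 1, HasDerivAt
      (fun t : ℝ => (bubbleVol (u + t • ξ)).1 * ξ.1 + (bubbleVol (u + t • ξ)).2 * ξ.2)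
      ((bubbleVolDeriv (u + t • ξ) ξ).1 * ξ.1 + (bubbleVolDeriv (u + t • ξ) ξ).2 * ξ.2) t := by
    intro t ht
    have := hasDerivAt_bubbleVol (hγ t) (hmem t ht)
    have d1 : HasDerivAt (fun t : ℝ => (bubbleVol (u + t • ξ)).1)
      (bubbleVolDeriv (u + t • ξ) ξ).1 t := this.fst
    have d2 : HasDerivAt (fun t : ℝ => (bubbleVol (u + t • ξ)).2)
      (bubbleVolDeriv (u + t • ξ) ξ).2 t := this.snd
    exact (d1.mul_const ξ.1).add (d2.mul_const ξ.2)
  obtain ⟨c, hc, hc'⟩ := exists_hasDerivAt_eq_zero (zero_lt_one (α := ℝ))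
    (fun t ht => (hder t ht).continuousAt.continuousWithinAt)
    (by simp [hξ, h]) (fun t ht => hder t (Set.Ioo_subset_Icc_self ht))
  exact (bubbleVolDeriv_inner_neg (hmem c (Set.Ioo_subset_Icc_self hc)) hξ0).ne hc'

/-! ### Lower bounds for the Legendre dual -/

/-- Geometrically the first quotient is the pole height over the circle height. Reflection in the
geodesic plane through the common circle changes the sign of `H` and is an inversion centred at the
origin, so the product of the two pole heights is fixed. -/
lemma log_capNum_add {s H E : ℝ} (hrel : s ^ 2 * (H ^ 2 + E ^ 2 - 1) = 1) (hD : 0 < 1 + s * E) :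
    Real.log ((1 + s * E + s ^ 2 * (1 - H)) / (1 + s * E)) +
      Real.log ((1 + s * E + s ^ 2 * (1 + H)) / (1 + s * E)) = Real.log (1 + s ^ 2) := by
  have hN := capNum_pos hrel hD
  have hM := capNum_pos (H := -H) (by rwa [neg_sq]) hD
  rw [sub_neg_eq_add] at hM
  rw [← Real.log_mul (div_pos hN hD).ne' (div_pos hM hD).ne']
  congr 1
  field_simp
  linear_combination (-s ^ 2) * hrel

lemma log_capNum_le {s H E : ℝ} (hrel : s ^ 2 * (H ^ 2 + E ^ 2 - 1) = 1) (hD : 0 < 1 + s * E)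
    (hH : 0 ≤ H) :
    Real.log ((1 + s * E + s ^ 2 * (1 - H)) / (1 + s * E)) ≤ Real.log (1 + s ^ 2) / 2 := by
  have hN := capNum_pos hrel hD
  have h := log_capNum_add hrel hD
  have : Real.log ((1 + s * E + s ^ 2 * (1 - H)) / (1 + s * E)) ≤
      Real.log ((1 + s * E + s ^ 2 * (1 + H)) / (1 + s * E)) := by
    apply Real.log_le_log (div_pos hN hD)
    apply div_le_div_of_nonneg_right _ hD.le
    nlinarith [sq_nonneg s, mul_nonneg (sq_nonneg s) hH]
  linarith

lemma le_log_capNum {s H E : ℝ} (hrel : s ^ 2 * (H ^ 2 + E ^ 2 - 1) = 1) (hD : 0 < 1 + s * E)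
    (hH : H ≤ 0) :
    Real.log (1 + s ^ 2) / 2 ≤ Real.log ((1 + s * E + s ^ 2 * (1 - H)) / (1 + s * E)) := by
  have h := log_capNum_add hrel hD
  have h2 := log_capNum_le (H := -H) (by rwa [neg_sq]) hD (by linarith)
  rw [sub_neg_eq_add] at h2
  linarith

/-- As the curvature `a` of an outer cap tends to that of a horosphere, its pole escapes at least
logarithmically: `1 + sE ≤ s² (a² - 1)` makes the quotient at least `1/(a - 1)`, while `s² < 3`
bounds the correction by `log 2`. -/
lemma le_log_capNum_of_lt_two {s a E : ℝ} (hrel : s ^ 2 * (a ^ 2 + E ^ 2 - 1) = 1)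
    (hD : 0 < 1 + s * E) (hs : 0 < s) (hs3 : s ^ 2 < 3) (ha : 1 < a) (hE : E ≤ 0) :
    -Real.log (2 * (a - 1)) ≤
      Real.log ((1 + s * E + s ^ 2 * (1 + a)) / (1 + s * E)) - Real.log (1 + s ^ 2) / 2 := by
  have h1 : Real.log (1 + s ^ 2) / 2 ≤ Real.log 2 := by
    have : Real.log (1 + s ^ 2) ≤ Real.log (2 ^ 2) := Real.log_le_log (by positivity) (by linarith)
    rw [Real.log_pow] at this
    push_cast at this
    linarith
  have h0 : s * E ≤ 0 := mul_nonpos_of_nonneg_of_nonpos hs.le hE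
  have h2 : 1 + s * E ≤ s ^ 2 * (a ^ 2 - 1) := by
    have : (1 + s * E) * (1 - s * E) = s ^ 2 * (a ^ 2 - 1) := by linear_combination -hrel
    nlinarith
  have h3 : (a - 1)⁻¹ ≤ (1 + s * E + s ^ 2 * (1 + a)) / (1 + s * E) := by
    have ha' : 0 < a - 1 := by linarith
    rw [inv_eq_one_div, div_le_div_iff₀ ha' hD]
    nlinarith
  have h4 := Real.log_le_log (inv_pos.2 (by linarith)) h3
  rw [Real.log_inv] at h4
  rw [Real.log_mul (by norm_num) (by linarith)]
  linarith

/-- The Legendre dual of the area, as a function of the mean curvatures. -/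
noncomputable def bubbleDual (u : ℝ × ℝ) : ℝ :=
  bubbleArea u - 2 * u.1 * (bubbleVol u).1 - 2 * u.2 * (bubbleVol u).2

/-- The logarithm of the relative height of the pole of a cap. -/
noncomputable def capLog (i : Fin 3) (u : ℝ × ℝ) : ℝ :=
  Real.log ((1 + circleRatio u * capE i u + circleRatio u ^ 2 * (1 - capH i u)) /
    (1 + circleRatio u * capE i u))

/-- The relation between `s`, `H` and `E` makes the rational part collapse to `sE - 1`, so that in
the sum over the caps only logarithms and a constant survive. -/
lemma capA_sub {u : ℝ × ℝ} (hu : u ∈ quadrant) (i : Fin 3) :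
    capA i u - capH i u * capW i u =
      circleRatio u * capE i u - 1 - capH i u * capLog i u := by
  have hD := (capD_pos hu i).ne'
  have hr := circleRatio_rel hu i
  unfold capA capW capLog
  generalize Real.log _ = l
  field_simp
  linear_combination -hr

lemma bubbleDual_eq {u : ℝ × ℝ} (hu : u ∈ quadrant) :
    bubbleDual u = 2 * Real.pi * (u.2 - u.1) * capLog 0 u + 2 * Real.pi * u.1 * capLog 1 u -
      2 * Real.pi * u.2 * capLog 2 u - 6 * Real.pi := by
  have h0 := capA_sub hu 0
  have h1 := capA_sub hu 1
  have h2 := capA_sub hu 2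
  simp only [capH_zero, capE_zero, capH_one, capE_one, capH_two, capE_two] at h0 h1 h2
  simp only [bubbleDual, bubbleArea, bubbleVol]
  linear_combination 2 * Real.pi * (h0 + h1 + h2)

/-- Since the curvatures sum to zero, `log (1 + s²) / 2` may be subtracted from every `capLog`. Each
term is then nonnegative, because a pole lies on the side of the geodesic plane through the circle
dictated by the sign of `H`; the term of the inner cap is dropped. -/
lemma bubbleDual_ge {u : ℝ × ℝ} (hu : u ∈ quadrant) :
    2 * Real.pi * (u.1 * (capLog 1 u - Real.log (1 + circleRatio u ^ 2) / 2)) +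
      2 * Real.pi * (u.2 * (Real.log (1 + circleRatio u ^ 2) / 2 - capLog 2 u)) - 6 * Real.pi ≤
        bubbleDual u := by
  rw [bubbleDual_eq hu]
  have h : 0 ≤ (u.2 - u.1) * (capLog 0 u - Real.log (1 + circleRatio u ^ 2) / 2) := by
    rcases le_total u.1 u.2 with hle | hle
    · have := le_log_capNum (circleRatio_rel hu 0) (capD_pos hu 0)
        (by rw [capH_zero]; linarith)
      exact mul_nonneg (by linarith) (sub_nonneg.2 this)
    · have := log_capNum_le (circleRatio_rel hu 0) (capD_pos hu 0)
        (by rw [capH_zero]; linarith)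
      exact mul_nonneg_of_nonpos_of_nonpos (by linarith) (sub_nonpos.2 this)
  nlinarith [mul_nonneg Real.pi_pos.le h]

lemma capLog_one_sub_nonneg {u : ℝ × ℝ} (hu : u ∈ quadrant) :
    0 ≤ capLog 1 u - Real.log (1 + circleRatio u ^ 2) / 2 := by
  have h1 : 1 < u.1 := hu.1
  exact sub_nonneg.2 (le_log_capNum (circleRatio_rel hu 1) (capD_pos hu 1)
    (by rw [capH_one]; linarith))

lemma sub_capLog_two_nonneg {u : ℝ × ℝ} (hu : u ∈ quadrant) :
    0 ≤ Real.log (1 + circleRatio u ^ 2) / 2 - capLog 2 u := by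
  have h1 : 1 < u.2 := hu.2
  exact sub_nonneg.2 (log_capNum_le (circleRatio_rel hu 2) (capD_pos hu 2)
    (by rw [capH_two]; linarith))

lemma bubbleDual_ge_const {u : ℝ × ℝ} (hu : u ∈ quadrant) : -6 * Real.pi ≤ bubbleDual u := by
  have h1 : 1 < u.1 := hu.1
  have h2 : 1 < u.2 := hu.2
  have := bubbleDual_ge hu
  have := mul_nonneg (zero_le_one.trans h1.le) (capLog_one_sub_nonneg hu)
  have := mul_nonneg (zero_le_one.trans h2.le) (sub_capLog_two_nonneg hu)
  have := Real.pi_pos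
  nlinarith

/-- The dual blows up at the edge `u.1 = 1`, which keeps minimisers off it. The bound `u.1 < 2`
serves to make `capE 1 u` negative. -/
lemma bubbleDual_ge_of_fst_lt {u : ℝ × ℝ} (hu : u ∈ quadrant) (h : u.1 < 2) :
    -2 * Real.pi * Real.log (2 * (u.1 - 1)) - 6 * Real.pi ≤ bubbleDual u := by
  have h1 : 1 < u.1 := hu.1
  have h2 : 1 < u.2 := hu.2
  have h3 := bubbleDual_ge hu
  have h4 := mul_nonneg (zero_le_one.trans h2.le) (sub_capLog_two_nonneg hu)
  have h5 := capLog_one_sub_nonneg hu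
  have hr := circleRatio_rel hu 1
  rw [capH_one, neg_sq] at hr
  have h6 := le_log_capNum_of_lt_two hr (capD_pos hu 1) (circleRatio_pos hu)
    (circleRatio_sq_lt hu) h1 (by
      rw [capE_one]; exact mul_nonpos_of_nonneg_of_nonpos (by positivity) (by linarith))
  have h7 : -Real.log (2 * (u.1 - 1)) ≤ capLog 1 u - Real.log (1 + circleRatio u ^ 2) / 2 := by
    rw [capLog, capH_one, sub_neg_eq_add]
    exact h6
  have h8 : -Real.log (2 * (u.1 - 1)) ≤
      u.1 * (capLog 1 u - Real.log (1 + circleRatio u ^ 2) / 2) := by nlinarith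
  have := Real.pi_pos
  nlinarith

lemma bubbleDual_ge_of_snd_lt {u : ℝ × ℝ} (hu : u ∈ quadrant) (h : u.2 < 2) :
    -2 * Real.pi * Real.log (2 * (u.2 - 1)) - 6 * Real.pi ≤ bubbleDual u := by
  have h1 : 1 < u.1 := hu.1
  have h2 : 1 < u.2 := hu.2
  have h3 := bubbleDual_ge hu
  have h4 := mul_nonneg (zero_le_one.trans h1.le) (capLog_one_sub_nonneg hu)
  have h5 := sub_capLog_two_nonneg hu
  have hr := circleRatio_rel hu 2
  rw [capH_two] at hr
  have h6 := le_log_capNum_of_lt_two hr (capD_pos hu 2) (circleRatio_pos hu)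
    (circleRatio_sq_lt hu) h2 (by
      rw [capE_two]; exact mul_nonpos_of_nonneg_of_nonpos (by positivity) (by linarith))
  have h7 : -Real.log (2 * (u.2 - 1)) ≤ Real.log (1 + circleRatio u ^ 2) / 2 - capLog 2 u := by
    have := log_capNum_add hr (capD_pos hu 2)
    rw [capLog, capH_two]
    linarith
  have h8 : -Real.log (2 * (u.2 - 1)) ≤
      u.2 * (Real.log (1 + circleRatio u ^ 2) / 2 - capLog 2 u) := by nlinarith
  have := Real.pi_pos
  nlinarith

/-! ### Existence of bubbles with given volumes, and the derivative of their area -/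

lemma contDiffAt_bubbleDual {u : ℝ × ℝ} (hu : u ∈ quadrant) : ContDiffAt ℝ 1 bubbleDual u := by
  have h1 := (contDiffAt_bubbleVol hu).fst
  have h2 := (contDiffAt_bubbleVol hu).snd
  have h3 := contDiffAt_bubbleArea hu
  unfold bubbleDual
  fun_prop

/-- By the first variation formula the derivatives of the volumes cancel, so the gradient of the
dual is minus twice the pair of volumes. -/
lemma hasDerivAt_bubbleDual {γ : ℝ → ℝ × ℝ} {ξ : ℝ × ℝ} {t : ℝ} (hγ : HasDerivAt γ ξ t)
    (ht : γ t ∈ quadrant) :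
    HasDerivAt (fun x => bubbleDual (γ x))
      (-2 * ξ.1 * (bubbleVol (γ t)).1 - 2 * ξ.2 * (bubbleVol (γ t)).2) t := by
  have hA := hasDerivAt_bubbleArea hγ ht
  have hV := hasDerivAt_bubbleVol hγ ht
  have d1 : HasDerivAt (fun t : ℝ => (bubbleVol (γ t)).1) (bubbleVolDeriv (γ t) ξ).1 t := hV.fst
  have d2 : HasDerivAt (fun t : ℝ => (bubbleVol (γ t)).2) (bubbleVolDeriv (γ t) ξ).2 t := hV.snd
  have g1 : HasDerivAt (fun t => (γ t).1) ξ.1 t := hγ.fst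
  have g2 : HasDerivAt (fun t => (γ t).2) ξ.2 t := hγ.snd
  refine ((hA.sub ((g1.const_mul 2).mul d1)).sub ((g2.const_mul 2).mul d2)).congr_deriv ?_
  ring

/-- Every pair of positive volumes is enclosed by some double bubble. -/
theorem exists_bubbleVol_eq {v w : ℝ} (hv : 0 < v) (hw : 0 < w) :
    ∃ u ∈ quadrant, bubbleVol u = (v, w) := by
  have hpi := Real.pi_pos
  -- A critical point of `G` is a bubble with volumes `(v, w)`. A minimum is sought on a box `[1+δ,
  -- N]²` outside which `G` exceeds its value `m` at `(2, 2)`.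
  set G : ℝ × ℝ → ℝ := fun u => bubbleDual u + 2 * v * u.1 + 2 * w * u.2 with hG
  have h22 : ((2, 2) : ℝ × ℝ) ∈ quadrant := by
    constructor <;> simp
  set m := G (2, 2) with hm
  set X := (|m| + 6 * Real.pi) / (2 * Real.pi) with hX
  have hXpos : 0 < X := by positivity
  have hXm : 2 * Real.pi * X = |m| + 6 * Real.pi := by rw [hX]; field_simp
  -- Chosen so that `-2π log (2(x - 1)) - 6π > |m|` for `1 < x < 1 + δ`: the logarithmic bound then
  -- beats `m` near either edge.
  set δ := Real.exp (-X) / 2 with hδ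
  have hδpos : 0 < δ := by positivity
  have hδ1 : δ < 1 := by
    have : Real.exp (-X) < Real.exp 0 := Real.exp_lt_exp.2 (by linarith)
    rw [Real.exp_zero] at this
    linarith
  -- Beyond `N` a linear term alone exceeds `|m| + 6π`, while the dual is at least `-6π`; the
  -- summand `2` puts `(2, 2)` in the box.
  set N := 2 + (|m| + 6 * Real.pi) / (2 * v) + (|m| + 6 * Real.pi) / (2 * w) with hN
  have hn1 : 0 < (|m| + 6 * Real.pi) / (2 * v) := by positivity
  have hn2 : 0 < (|m| + 6 * Real.pi) / (2 * w) := by positivity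
  have hNv : |m| + 6 * Real.pi < 2 * v * N := by
    have : 2 * v * ((|m| + 6 * Real.pi) / (2 * v)) = |m| + 6 * Real.pi := by field_simp
    rw [hN]; nlinarith
  have hNw : |m| + 6 * Real.pi < 2 * w * N := by
    have : 2 * w * ((|m| + 6 * Real.pi) / (2 * w)) = |m| + 6 * Real.pi := by field_simp
    rw [hN]; nlinarith
  have hm_le := le_abs_self m
  have hlog : ∀ x : ℝ, 1 < x → x < 1 + δ → X < -Real.log (2 * (x - 1)) := by
    intro x hx1 hx2
    have : Real.log (2 * (x - 1)) < Real.log (2 * δ) :=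
      Real.log_lt_log (by linarith) (by linarith)
    have h2 : Real.log (2 * δ) = -X := by
      rw [hδ, mul_div_cancel₀ _ (two_ne_zero), Real.log_exp]
    linarith
  have hout : ∀ u ∈ quadrant, u ∉ Set.Icc (1 + δ) N ×ˢ Set.Icc (1 + δ) N → m < G u := by
    intro u hu hnot
    have h1 : 1 < u.1 := hu.1
    have h2 : 1 < u.2 := hu.2
    have p1 : 0 < v * u.1 := by positivity
    have p2 : 0 < w * u.2 := by positivity
    have hc := bubbleDual_ge_const hu
    simp only [hG]
    by_cases c1 : u.1 < 1 + δ
    · have := bubbleDual_ge_of_fst_lt hu (by linarith)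
      have := hlog _ h1 c1
      nlinarith
    by_cases c2 : u.2 < 1 + δ
    · have := bubbleDual_ge_of_snd_lt hu (by linarith)
      have := hlog _ h2 c2
      nlinarith
    by_cases c3 : N < u.1
    · nlinarith
    by_cases c4 : N < u.2
    · nlinarith
    push Not at c1 c2 c3 c4
    exact absurd ⟨⟨c1, c3⟩, ⟨c2, c4⟩⟩ hnot
  have hsub : Set.Icc (1 + δ) N ×ˢ Set.Icc (1 + δ) N ⊆ quadrant := fun u hu =>
    ⟨by have := hu.1.1; simp only [Set.mem_Ioi]; linarith,
      by have := hu.2.1; simp only [Set.mem_Ioi]; linarith⟩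
  have hcont : ContinuousOn G (Set.Icc (1 + δ) N ×ˢ Set.Icc (1 + δ) N) := by
    intro u hu
    have := (contDiffAt_bubbleDual (hsub hu)).continuousAt
    apply ContinuousAt.continuousWithinAt
    simp only [hG]
    fun_prop
  have hmem : ((2, 2) : ℝ × ℝ) ∈ Set.Icc (1 + δ) N ×ˢ Set.Icc (1 + δ) N := by
    refine ⟨⟨?_, ?_⟩, ⟨?_, ?_⟩⟩ <;> simp only <;> linarith
  obtain ⟨u, hu, hmin⟩ := (isCompact_Icc.prod isCompact_Icc).exists_isMinOn ⟨_, hmem⟩ hcont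
  have huQ := hsub hu
  have hminQ : ∀ u' ∈ quadrant, G u ≤ G u' := by
    intro u' hu'
    by_cases h : u' ∈ Set.Icc (1 + δ) N ×ˢ Set.Icc (1 + δ) N
    · exact hmin h
    · exact (hmin hmem).trans (hout u' hu' h).le
  have hcrit : ∀ ξ : ℝ × ℝ, 2 * ξ.1 * (v - (bubbleVol u).1) + 2 * ξ.2 * (w - (bubbleVol u).2) = 0 := by
    intro ξ
    have hγ : HasDerivAt (fun t : ℝ => u + t • ξ) ξ 0 := by
      simpa using ((hasDerivAt_id (0 : ℝ)).smul_const ξ).const_add u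
    have h0 : u + (0 : ℝ) • ξ = u := by simp
    have hd := hasDerivAt_bubbleDual hγ (by rwa [h0])
    have g1 : HasDerivAt (fun t : ℝ => (u + t • ξ).1) ξ.1 0 := hγ.fst
    have g2 : HasDerivAt (fun t : ℝ => (u + t • ξ).2) ξ.2 0 := hγ.snd
    have hGd := (hd.add (g1.const_mul (2 * v))).add (g2.const_mul (2 * w))
    have hloc : IsLocalMin (fun t : ℝ => G (u + t • ξ)) 0 := by
      have hev : ∀ᶠ t : ℝ in nhds 0, u + t • ξ ∈ quadrant := by
        apply hγ.continuousAt.eventually_mem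
        rw [h0]
        exact isOpen_quadrant.mem_nhds huQ
      filter_upwards [hev] with t ht
      simp only [h0]
      exact hminQ _ ht
    have hz := hloc.hasDerivAt_eq_zero hGd
    rw [h0] at hz
    linarith
  refine ⟨u, huQ, Prod.ext ?_ ?_⟩
  · have := hcrit (1, 0)
    simp only at this ⊢
    linarith
  · have := hcrit (0, 1)
    simp only at this ⊢
    linarith

/-- The derivative of the area of the double bubble with respect to the volume of the upper region
is twice the mean curvature of the upper outer cap. -/
theorem hasDerivAt_of_eq_bubbleArea {a : ℝ → ℝ} {v w : ℝ}
    (ha : ∀ᶠ x in nhds v, ∀ u ∈ quadrant, bubbleVol u = (x, w) → a x = bubbleArea u) {u : ℝ × ℝ}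
    (hu : u ∈ quadrant) (hv : bubbleVol u = (v, w)) : HasDerivAt a (2 * u.1) v := by
  have hinj : Function.Injective (fderiv ℝ bubbleVol u) := by
    rw [injective_iff_map_eq_zero]
    intro ξ hξ
    by_contra hne
    have := bubbleVolDeriv_inner_neg hu hne
    rw [← fderiv_bubbleVol hu, hξ] at this
    simp at this
  let e : (ℝ × ℝ) ≃L[ℝ] (ℝ × ℝ) :=
    (LinearEquiv.ofInjectiveEndo (fderiv ℝ bubbleVol u : ℝ × ℝ →ₗ[ℝ] ℝ × ℝ)
      hinj).toContinuousLinearEquiv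
  have he : (e : ℝ × ℝ →L[ℝ] ℝ × ℝ) = fderiv ℝ bubbleVol u := by
    rfl
  have hs : HasStrictFDerivAt bubbleVol (e : ℝ × ℝ →L[ℝ] ℝ × ℝ) u := by
    rw [he]; exact (contDiffAt_bubbleVol hu).hasStrictFDerivAt one_ne_zero
  set g := hs.localInverse bubbleVol e u with hg
  have hgd : HasStrictFDerivAt g (e.symm : ℝ × ℝ →L[ℝ] ℝ × ℝ) (bubbleVol u) := hs.to_localInverse
  have hgu : g (bubbleVol u) = u := hs.localInverse_apply_image
  have hright := hs.eventually_right_inverse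
  rw [hv] at hgd hgu hright
  -- Only `v` varies. The local inverse of the volume map lifts this line to a curve of curvatures
  -- whose volume derivative is `(1, 0)`, and the first variation leaves `2 u.1`.
  have hline : HasDerivAt (fun x : ℝ => ((x, w) : ℝ × ℝ)) (1, 0) v :=
    (hasDerivAt_id v).prodMk (hasDerivAt_const v w)
  have hγ : HasDerivAt (fun x : ℝ => g (x, w)) (e.symm (1, 0)) v :=
    HasFDerivAt.comp_hasDerivAt (f := fun x : ℝ => ((x, w) : ℝ × ℝ)) v hgd.hasFDerivAt hline
  have hA := hasDerivAt_bubbleArea hγ (by rwa [hgu])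
  rw [hgu] at hA
  have hξ : bubbleVolDeriv u (e.symm (1, 0)) = (1, 0) := by
    rw [← fderiv_bubbleVol hu, ← he]
    exact e.apply_symm_apply _
  rw [hξ] at hA
  simp only [mul_one, mul_zero, add_zero] at hA
  apply hA.congr_of_eventuallyEq
  have hmemQ : ∀ᶠ x in nhds v, g (x, w) ∈ quadrant := by
    apply hγ.continuousAt.eventually_mem
    rw [hgu]
    exact isOpen_quadrant.mem_nhds hu
  filter_upwards [hmemQ, hline.continuousAt.eventually hright, ha] with x hx1 hx2 hx
  exact hx _ hx1 hx2

/-! ### Rotation of frames by 120° -/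

lemma sin_two_pi_div_three : Real.sin (2 * Real.pi / 3) = √3 / 2 := by
  rw [show 2 * Real.pi / 3 = Real.pi - Real.pi / 3 by ring, Real.sin_pi_sub,
    Real.sin_pi_div_three]

lemma cos_two_pi_div_three : Real.cos (2 * Real.pi / 3) = -1 / 2 := by
  rw [show 2 * Real.pi / 3 = Real.pi - Real.pi / 3 by ring, Real.cos_pi_sub,
    Real.cos_pi_div_three]
  norm_num

lemma inv_sqrt_three_mul : (√3)⁻¹ = √3 / 3 := by
  have : √3 ^ 2 = (3 : ℝ) := Real.sq_sqrt (by norm_num)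
  field_simp
  linarith

/-- The angles `x`, `x - 2π/3`, `x + 2π/3`. -/
noncomputable def trisect (x : ℝ) : Fin 3 → ℝ :=
  ![x, x - 2 * Real.pi / 3, x + 2 * Real.pi / 3]

/-- If `capH 0` and `capE 0` are obtained from the sine and cosine of an angle by a linear
substitution, so are the other `capH i` and `capE i`. -/
lemma capH_capE_of_trisect {u : ℝ × ℝ} {x a b : ℝ}
    (hH : capH 0 u = a * Real.sin x + b * Real.cos x)
    (hE : capE 0 u = a * Real.cos x - b * Real.sin x) (i : Fin 3) :
    capH i u = a * Real.sin (trisect x i) + b * Real.cos (trisect x i) ∧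
      capE i u = a * Real.cos (trisect x i) - b * Real.sin (trisect x i) := by
  have h3 : √3 ^ 2 = (3 : ℝ) := Real.sq_sqrt (by norm_num)
  rw [capH_zero] at hH
  rw [capE_zero, inv_sqrt_three_mul] at hE
  have hs : u.1 + u.2 = √3 * (a * Real.cos x - b * Real.sin x) := by
    linear_combination √3 * hE - (u.1 + u.2) / 3 * h3
  fin_cases i
  · simp only [trisect, Fin.zero_eta, capH_zero, capE_zero, Matrix.cons_val_zero]
    rw [inv_sqrt_three_mul]
    exact ⟨hH, hE⟩
  · simp only [trisect, Fin.mk_one, capH_one, capE_one, Matrix.cons_val_one, Matrix.cons_val_zero]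
    rw [Real.sin_sub, Real.cos_sub, sin_two_pi_div_three, cos_two_pi_div_three, inv_sqrt_three_mul]
    constructor
    · linear_combination -(1 / 2) * hH - (1 / 2) * hs
    · linear_combination √3 / 2 * hH - √3 / 6 * hs -
        (a * Real.cos x - b * Real.sin x) / 6 * h3
  · simp only [trisect, Fin.reduceFinMk, capH_two, capE_two, Matrix.cons_val]
    rw [Real.sin_add, Real.cos_add, sin_two_pi_div_three, cos_two_pi_div_three, inv_sqrt_three_mul]
    constructor
    · linear_combination -(1 / 2) * hH + (1 / 2) * hs
    · linear_combination -√3 / 2 * hH - √3 / 6 * hs -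
        (a * Real.cos x - b * Real.sin x) / 6 * h3

/-! ### Volumes and area of a bubble in terms of its mean curvatures -/

namespace StandardDoubleBubble

variable (B : StandardDoubleBubble)

/-- The mean curvatures of the two outer caps. -/
noncomputable def curv : ℝ × ℝ := (-(1 + B.κ 1 * B.h 1), 1 + B.κ 2 * B.h 2)

lemma turn_eq_trisect (i : Fin 3) : B.turn i = trisect (B.turn 0) i := by
  fin_cases i
  · rfl
  · exact B.turn_one
  · exact B.turn_two

/-- Mean curvature greater than one is the condition that both Euclidean poles of the sphere lie in
the half-space; `upper_sphere` supplies it for the upper outer cap, and `lower_sphere` with the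
positive lower pole for the other. -/
lemma curv_mem_quadrant : B.curv ∈ quadrant := by
  constructor
  · have h1 := B.upper_sphere.2
    have h2 := B.upper_neg
    have h3 : B.κ 1 * (B.h 1 + 2 / B.κ 1) < 0 := mul_neg_of_neg_of_pos h2 h1
    rw [mul_add, mul_div_cancel₀ _ h2.ne] at h3
    simp only [curv, Set.mem_Ioi]
    linarith
  · have := mul_pos B.lower_sphere (B.h_pos 2)
    simp only [curv, Set.mem_Ioi]
    linarith

lemma one_add_κ_mul_h (i : Fin 3) : 1 + B.κ i * B.h i =
    B.circleHeight / B.circleRadius * Real.sin (B.turn i) + 1 * Real.cos (B.turn i) := by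
  have h1 := B.κ_mul_circleRadius i
  have h2 := B.κ_mul_circleHeight_sub i
  have hR := B.circleRadius_pos.ne'
  rw [← h1]
  field_simp
  linarith

/-- For every cap `1 + κ h` is the same linear combination of sine and cosine of its turn. The turns
differ by 120°, which forces the inner curvature to be `u.1 - u.2` and identifies `capE` with the
rotated frame. -/
lemma capH_capE_curv (i : Fin 3) :
    capH i B.curv = B.circleHeight / B.circleRadius * Real.sin (B.turn i) +
      1 * Real.cos (B.turn i) ∧
    capE i B.curv = B.circleHeight / B.circleRadius * Real.cos (B.turn i) -
      1 * Real.sin (B.turn i) := by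
  have h3 : √3 ^ 2 = (3 : ℝ) := Real.sq_sqrt (by norm_num)
  rw [B.turn_eq_trisect i]
  apply capH_capE_of_trisect
  · rw [capH_zero]
    simp only [curv]
    rw [B.one_add_κ_mul_h 1, B.one_add_κ_mul_h 2, B.turn_one, B.turn_two, Real.sin_sub,
      Real.cos_sub, Real.sin_add, Real.cos_add, cos_two_pi_div_three]
    ring
  · rw [capE_zero, inv_sqrt_three_mul]
    simp only [curv]
    rw [B.one_add_κ_mul_h 1, B.one_add_κ_mul_h 2, B.turn_one, B.turn_two, Real.sin_sub,
      Real.cos_sub, Real.sin_add, Real.cos_add, sin_two_pi_div_three]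
    linear_combination (B.circleHeight / B.circleRadius * Real.cos (B.turn 0) -
      1 * Real.sin (B.turn 0)) / 3 * h3

lemma circleRatio_curv : circleRatio B.curv = B.circleRadius / B.circleHeight := by
  have hR := B.circleRadius_pos
  have hT := B.circleHeight_pos
  have h := capH_sq_add_capE_sq 0 B.curv
  rw [(B.capH_capE_curv 0).1, (B.capH_capE_curv 0).2] at h
  rw [circleRatio, ← h, show (B.circleHeight / B.circleRadius * Real.sin (B.turn 0) +
      1 * Real.cos (B.turn 0)) ^ 2 + (B.circleHeight / B.circleRadius * Real.cos (B.turn 0) -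
      1 * Real.sin (B.turn 0)) ^ 2 - 1 = (B.circleHeight / B.circleRadius) ^ 2 by
    linear_combination ((B.circleHeight / B.circleRadius) ^ 2 + 1) *
      Real.sin_sq_add_cos_sq (B.turn 0), Real.sqrt_sq (by positivity), inv_div]

lemma capD_curv (i : Fin 3) : 1 + circleRatio B.curv * capE i B.curv =
    (1 + Real.cos (B.turn i)) * B.h i / B.circleHeight := by
  have hR := B.circleRadius_pos.ne'
  have hT := B.circleHeight_pos.ne'
  have h := B.circleRadius_mul_sin i
  rw [B.circleRatio_curv, (B.capH_capE_curv i).2]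
  field_simp
  linear_combination -h

lemma circleRadius_sq_mul (i : Fin 3) : B.circleRadius ^ 2 * (1 - Real.cos (B.turn i)) =
    (B.circleHeight - B.h i) ^ 2 * (1 + Real.cos (B.turn i)) := by
  have h := B.circleRadius_mul_sin i
  have h1 := B.neg_one_lt_cos_turn i
  have h2 := Real.sin_sq_add_cos_sq (B.turn i)
  have h3 : (1 + Real.cos (B.turn i)) * (B.circleRadius ^ 2 * (1 - Real.cos (B.turn i))) =
    (1 + Real.cos (B.turn i)) * ((B.circleHeight - B.h i) ^ 2 * (1 + Real.cos (B.turn i))) := by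
    linear_combination (B.circleRadius * Real.sin (B.turn i) +
      (B.circleHeight - B.h i) * (1 + Real.cos (B.turn i))) * h - B.circleRadius ^ 2 * h2
  exact mul_left_cancel₀ (by linarith) h3

lemma capA_curv (i : Fin 3) : capA i B.curv = (B.circleRadius ^ 2 +
    (B.circleHeight - B.h i) ^ 2) / (2 * B.h i * B.circleHeight) := by
  have hT := B.circleHeight_pos.ne'
  have hh := (B.h_pos i).ne'
  have hc : 1 + Real.cos (B.turn i) ≠ 0 := by linarith [B.neg_one_lt_cos_turn i]
  have h := B.circleRadius_sq_mul i
  rw [capA, B.capD_curv, B.circleRatio_curv]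
  field_simp
  linear_combination h

lemma capW_curv (i : Fin 3) : Real.pi * (capW i B.curv - circleRatio B.curv ^ 2 / 2) =
    capVolume (B.h i) (B.κ i) B.circleHeight := by
  have hT := B.circleHeight_pos
  have hR := B.circleRadius_pos
  have hh := B.h_pos i
  have hc : 0 < 1 + Real.cos (B.turn i) := by linarith [B.neg_one_lt_cos_turn i]
  have h := B.circleRadius_mul_sin i
  have h' := B.circleRadius_sq_mul i
  have hd : discSq (B.h i) (B.κ i) B.circleHeight * (B.circleHeight - B.h i) =
      B.circleRadius ^ 2 * (B.circleHeight - B.h i) := by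
    by_cases hκ : B.κ i = 0
    · have := B.circleHeight_sub_eq i
      rw [turn, hκ, zero_mul, zero_div, Real.tan_zero, mul_zero] at this
      rw [this, mul_zero, mul_zero]
    · rw [B.discSq_circleHeight hκ]
  rw [capVolume_eq hh hT, hd, capW]
  -- The argument of the logarithm is the ratio of pole height to circle height.
  have hlog : (1 + circleRatio B.curv * capE i B.curv +
      circleRatio B.curv ^ 2 * (1 - capH i B.curv)) / (1 + circleRatio B.curv * capE i B.curv) =
      B.h i / B.circleHeight := by
    have h1 : capH i B.curv = 1 + B.κ i * B.h i := by
      rw [(B.capH_capE_curv i).1, B.one_add_κ_mul_h]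
    have h2 := B.κ_mul_circleRadius i
    rw [B.capD_curv, h1, B.circleRatio_curv]
    field_simp
    linear_combination B.h i * (-h - B.circleRadius * h2)
  rw [hlog, B.capD_curv, (B.capH_capE_curv i).1, B.circleRatio_curv]
  congr 1
  generalize Real.log _ = l
  field_simp
  linear_combination B.circleHeight * (2 * B.circleHeight * h - h')

theorem hypVolume_upperRegion_eq :
    hypVolume B.upperRegion = ENNReal.ofReal (bubbleVol B.curv).1 := by
  rw [B.hypVolume_upperRegion, ← B.capW_curv, ← B.capW_curv, bubbleVol]
  congr 1
  ring

theorem hypVolume_lowerRegion_eq :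
    hypVolume B.lowerRegion = ENNReal.ofReal (bubbleVol B.curv).2 := by
  rw [B.hypVolume_lowerRegion, ← B.capW_curv, ← B.capW_curv, bubbleVol]
  congr 1
  ring

theorem area_eq : B.area = bubbleArea B.curv := by
  have h : ∀ i, capArea (B.h i) (B.κ i) (B.ℓ i) = 2 * Real.pi * capA i B.curv := by
    intro i
    have hT := B.circleHeight_pos
    have hh := B.h_pos i
    rw [capArea_eq hh (B.ℓ_pos i).le (B.arc_lt i).le (by rwa [B.profileHeight_eq]),
      B.profileHeight_eq, B.profileRadius_eq, B.capA_curv]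
    field_simp
  rw [area, Fin.sum_univ_three, h, h, h, bubbleArea]
  ring

end StandardDoubleBubble

/-! ### Construction of double bubbles -/

/-- The length of an arc that turns by `x` and ends at distance `s` from the axis. -/
noncomputable def arcLength (s x : ℝ) : ℝ := if x = 0 then s else s * x / Real.sin x

lemma sin_ne_zero_of_mem {x : ℝ} (hx : x ∈ Set.Ioo (-Real.pi) Real.pi) (h0 : x ≠ 0) :
    Real.sin x ≠ 0 := by
  rcases lt_or_gt_of_ne h0 with h | h
  · exact (Real.sin_neg_of_neg_of_neg_pi_lt h hx.1).ne
  · exact (Real.sin_pos_of_pos_of_lt_pi h hx.2).ne'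

lemma arcLength_pos {s x : ℝ} (hs : 0 < s) (hx : x ∈ Set.Ioo (-Real.pi) Real.pi) :
    0 < arcLength s x := by
  unfold arcLength
  split_ifs with h0
  · exact hs
  · rcases lt_or_gt_of_ne h0 with h | h
    · exact div_pos_of_neg_of_neg (mul_neg_of_pos_of_neg hs h)
        (Real.sin_neg_of_neg_of_neg_pi_lt h hx.1)
    · exact div_pos (mul_pos hs h) (Real.sin_pos_of_pos_of_lt_pi h hx.2)

lemma curvature_mul_arcLength {s x : ℝ} (hs : 0 < s) (hx : x ∈ Set.Ioo (-Real.pi) Real.pi) :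
    Real.sin x / s * arcLength s x = x := by
  unfold arcLength
  split_ifs with h0
  · simp [h0]
  · have := sin_ne_zero_of_mem hx h0
    field_simp

lemma profileRadius_arcLength {s x : ℝ} (hs : 0 < s) (hx : x ∈ Set.Ioo (-Real.pi) Real.pi) :
    profileRadius (Real.sin x / s) (arcLength s x) = s := by
  by_cases h0 : x = 0
  · simp [h0, arcLength, profileRadius_zero_left]
  · have hsin := sin_ne_zero_of_mem hx h0
    have h := mul_profileRadius (Real.sin x / s) (arcLength s x)
    rw [curvature_mul_arcLength hs hx] at h
    field_simp at h
    exact h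

/-- Dilations are isometries, so the common circle may be put at height `1`; the half-angle formula
dictates the pole. -/
lemma profileHeight_arcLength {s x : ℝ} (hs : 0 < s) (hx : x ∈ Set.Ioo (-Real.pi) Real.pi) :
    profileHeight (1 - s * Real.tan (x / 2)) (Real.sin x / s) (arcLength s x) = 1 := by
  have h := profileHeight_sub_eq_mul_tan (h := 1 - s * Real.tan (x / 2))
    (κ := Real.sin x / s) (ℓ := arcLength s x) (by rwa [curvature_mul_arcLength hs hx])
  rw [curvature_mul_arcLength hs hx, profileRadius_arcLength hs hx] at h
  linarith

lemma sin_mul_tan_half {x : ℝ} (hx : x ∈ Set.Ioo (-Real.pi) Real.pi) :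
    Real.sin x * Real.tan (x / 2) = 1 - Real.cos x := by
  have hc : 0 < Real.cos (x / 2) :=
    Real.cos_pos_of_mem_Ioo ⟨by linarith [hx.1], by linarith [hx.2]⟩
  have h1 : Real.sin x = 2 * Real.sin (x / 2) * Real.cos (x / 2) := by
    rw [← Real.sin_two_mul]; congr 1; ring
  have h2 : Real.cos x = 1 - 2 * Real.sin (x / 2) ^ 2 := by
    have h3 : Real.cos x = 2 * Real.cos (x / 2) ^ 2 - 1 := by
      rw [← Real.cos_two_mul]; congr 1; ring
    linear_combination h3 + 2 * Real.sin_sq_add_cos_sq (x / 2)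
  rw [h1, h2, Real.tan_eq_sin_div_cos]
  field_simp
  ring

lemma one_add_cos_mul_tan_half {x : ℝ} (hx : x ∈ Set.Ioo (-Real.pi) Real.pi) :
    (1 + Real.cos x) * Real.tan (x / 2) = Real.sin x := by
  have hc : 0 < Real.cos (x / 2) :=
    Real.cos_pos_of_mem_Ioo ⟨by linarith [hx.1], by linarith [hx.2]⟩
  have h1 : Real.sin x = 2 * Real.sin (x / 2) * Real.cos (x / 2) := by
    rw [← Real.sin_two_mul]; congr 1; ring
  have h2 : Real.cos x = 2 * Real.cos (x / 2) ^ 2 - 1 := by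
    rw [← Real.cos_two_mul]; congr 1; ring
  rw [h1, h2, Real.tan_eq_sin_div_cos]
  field_simp
  ring

lemma cos_trisect_sub {x : ℝ} {i j : Fin 3} (hij : i ≠ j) :
    Real.cos (trisect x i - trisect x j) = Real.cos (2 * Real.pi / 3) := by
  have h4 : Real.cos (4 * Real.pi / 3) = Real.cos (2 * Real.pi / 3) := by
    rw [← Real.cos_two_pi_sub]; congr 1; ring
  fin_cases i <;> fin_cases j <;> first
    | exact absurd rfl hij
    | (simp only [trisect, Fin.zero_eta, Fin.mk_one, Fin.reduceFinMk, Matrix.cons_val]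
       first
        | (congr 1; ring1)
        | (rw [← Real.cos_neg]; congr 1; ring1)
        | (rw [← h4]; congr 1; ring1)
        | (rw [← h4, ← Real.cos_neg]; congr 1; ring1))

/-- A double bubble from an angle `x` and the ratio `s` of radius and height of its circle. -/
lemma exists_bubble_of_angle {u : ℝ × ℝ} (hu : u ∈ quadrant) {s x : ℝ} (hs : 0 < s)
    (hmem : ∀ i, trisect x i ∈ Set.Ioo (-Real.pi) Real.pi)
    (hH : ∀ i, s * capH i u = Real.sin (trisect x i) + s * Real.cos (trisect x i))
    (hD : 0 < 1 + Real.cos (trisect x 2) - s * Real.sin (trisect x 2)) :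
    ∃ B : StandardDoubleBubble, B.curv = u := by
  have hpi := Real.pi_pos
  have h1 : 1 < u.1 := hu.1
  have h2 : 1 < u.2 := hu.2
  have htan : ∀ i j, trisect x i < trisect x j →
      1 - s * Real.tan (trisect x j / 2) < 1 - s * Real.tan (trisect x i / 2) := by
    intro i j hij
    have hi := hmem i
    have hj := hmem j
    have := Real.strictMonoOn_tan (a := trisect x i / 2) (b := trisect x j / 2)
      ⟨by linarith [hi.1], by linarith [hi.2]⟩ ⟨by linarith [hj.1], by linarith [hj.2]⟩
      (by linarith)
    nlinarith
  have l20 := htan 0 2 (by simp [trisect]; positivity)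
  have l01 := htan 1 0 (by simp [trisect]; positivity)
  -- Only the lowest of the three poles needs checking, and `hD` is its height times `1 + cos`.
  have hp2 : 0 < 1 - s * Real.tan (trisect x 2 / 2) := by
    have e := one_add_cos_mul_tan_half (hmem 2)
    have hc : 0 < Real.cos (trisect x 2 / 2) :=
      Real.cos_pos_of_mem_Ioo ⟨by linarith [(hmem 2).1], by linarith [(hmem 2).2]⟩
    have hcc : 0 ≤ 1 + Real.cos (trisect x 2) := by linarith [Real.neg_one_le_cos (trisect x 2)]
    have : 0 < (1 + Real.cos (trisect x 2)) * (1 - s * Real.tan (trisect x 2 / 2)) := by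
      rw [← e] at hD; linarith
    exact pos_of_mul_pos_right this hcc
  have hpos : ∀ i : Fin 3, 0 < 1 - s * Real.tan (trisect x i / 2) := by
    intro i
    fin_cases i
    · exact hp2.trans l20
    · exact (hp2.trans l20).trans l01
    · exact hp2
  have hcurv : ∀ i : Fin 3,
      1 + Real.sin (trisect x i) / s * (1 - s * Real.tan (trisect x i / 2)) = capH i u := by
    intro i
    have e := sin_mul_tan_half (hmem i)
    have hi := hH i
    field_simp
    linear_combination -s * e - hi
  have hc1 := hcurv 1
  have hc2 := hcurv 2
  rw [capH_one] at hc1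
  rw [capH_two] at hc2
  have hκ2 : 0 < Real.sin (trisect x 2) / s :=
    pos_of_mul_pos_left (b := 1 - s * Real.tan (trisect x 2 / 2)) (by linarith) hp2.le
  have hκ1 : Real.sin (trisect x 1) / s < 0 :=
    neg_of_mul_neg_left (b := 1 - s * Real.tan (trisect x 1 / 2)) (by linarith) (hpos 1).le
  have hkl := fun i => curvature_mul_arcLength hs (hmem i)
  refine ⟨{ h := fun i => 1 - s * Real.tan (trisect x i / 2)
            κ := fun i => Real.sin (trisect x i) / s
            ℓ := fun i => arcLength s (trisect x i)
            h_pos := hpos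
            ℓ_pos := fun i => arcLength_pos hs (hmem i)
            arc_lt := fun i => ?_
            lower_lt := l20
            lt_upper := l01
            upper_sphere := ⟨hκ1, ?_⟩
            lower_sphere := hκ2
            common_circle := fun i j θ => ?_
            angle_eq := fun i j hij θ => ?_ }, ?_⟩
  · rw [← abs_of_pos (arcLength_pos hs (hmem i)), ← abs_mul, hkl]
    exact abs_lt.2 (hmem i)
  · have h3 : Real.sin (trisect x 1) / s *
        (1 - s * Real.tan (trisect x 1 / 2) + 2 / (Real.sin (trisect x 1) / s)) < 0 := by
      rw [mul_add, mul_div_cancel₀ _ hκ1.ne]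
      linarith
    exact pos_of_mul_neg_right h3 hκ1.le
  · simp only [cap]
    rw [profileRadius_arcLength hs (hmem i), profileRadius_arcLength hs (hmem j),
      profileHeight_arcLength hs (hmem i), profileHeight_arcLength hs (hmem j)]
  · rw [hypAngle_cap (by rw [profileHeight_arcLength hs (hmem i)]; exact one_pos), hkl, hkl,
      cos_trisect_sub hij, Real.arccos_cos (by positivity) (by linarith)]
  · simp only [StandardDoubleBubble.curv]
    rw [hc1, hc2, neg_neg]

/-- In polar coordinates `(capE 0 u, capH 0 u)` has angle `θ` and radius `√(1 + s²)/s`. As the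
vector `(1/s, 1)` has that length too, subtracting its angle `α = arctan s` gives the turn `θ - α`
of the inner arc. -/
theorem exists_bubble_of_mem_quadrant {u : ℝ × ℝ} (hu : u ∈ quadrant) :
    ∃ B : StandardDoubleBubble, B.curv = u := by
  have hpi := Real.pi_pos
  have h1 : 1 < u.1 := hu.1
  have h2 : 1 < u.2 := hu.2
  set s := circleRatio u with hs_def
  have hs : 0 < s := circleRatio_pos hu
  have hE0 : 0 < capE 0 u := by
    rw [capE_zero]
    have : 0 < u.1 + u.2 := by linarith
    positivity
  have hr := circleRatio_rel hu 0
  rw [← hs_def] at hr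
  set S := √(1 + s ^ 2) with hS
  have hSpos : 0 < S := by positivity
  have hS2 : S ^ 2 = 1 + s ^ 2 := Real.sq_sqrt (by positivity)
  set α := Real.arctan s with hα
  have hcosα : Real.cos α = 1 / S := Real.cos_arctan s
  have hsinα : Real.sin α = s / S := Real.sin_arctan s
  have hα0 : 0 < α := Real.arctan_pos.2 hs
  have hα1 : α < Real.pi / 2 := Real.arctan_lt_pi_div_two s
  set θ := Real.arctan (capH 0 u / capE 0 u) with hθ
  have hsq : √(1 + (capH 0 u / capE 0 u) ^ 2) = S / (s * capE 0 u) := by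
    rw [show 1 + (capH 0 u / capE 0 u) ^ 2 = (S / (s * capE 0 u)) ^ 2 by
      rw [div_pow, div_pow, hS2]; field_simp; linear_combination hr, Real.sqrt_sq (by positivity)]
  have hcosθ : S * Real.cos θ = s * capE 0 u := by
    rw [hθ, Real.cos_arctan, hsq]; field_simp
  have hsinθ : S * Real.sin θ = s * capH 0 u := by
    rw [hθ, Real.sin_arctan, hsq]; field_simp
  have htan3 : Real.arctan √3 = Real.pi / 3 := by
    rw [← Real.tan_pi_div_three, Real.arctan_tan (by linarith) (by linarith)]
  have hq : 0 < √3 := by positivity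
  have h3 : √3 ^ 2 = (3 : ℝ) := Real.sq_sqrt (by norm_num)
  -- The tangent of `θ` is `√3 (u.1 - u.2)/(u.1 + u.2)`, which lies strictly between `-√3` and `√3`.
  have hθ1 : θ < Real.pi / 3 := by
    rw [← htan3]
    apply Real.arctan_strictMono
    rw [div_lt_iff₀ hE0, capE_zero, capH_zero, mul_inv_cancel_left₀ hq.ne']
    linarith
  have hθ2 : -(Real.pi / 3) < θ := by
    rw [← htan3, ← Real.arctan_neg]
    apply Real.arctan_strictMono
    rw [lt_div_iff₀ hE0, capE_zero, capH_zero, neg_mul, mul_inv_cancel_left₀ hq.ne']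
    linarith
  have hrotθ := fun i => capH_capE_of_trisect (u := u) (x := θ) (a := S / s) (b := 0)
    (by field_simp; linarith) (by field_simp; linarith) i
  have hrot := fun i => capH_capE_of_trisect (u := u) (x := θ - α) (a := 1 / s) (b := 1)
    (by
      rw [Real.sin_sub, Real.cos_sub, hcosα, hsinα]
      field_simp
      linear_combination -S * hsinθ + Real.sin θ * hS2)
    (by
      rw [Real.sin_sub, Real.cos_sub, hcosα, hsinα]
      field_simp
      linear_combination -S * hcosθ + Real.cos θ * hS2) i
  -- The upper outer arc must turn by less than `π`; this follows from positivity of `1 + s * capE 1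
  -- u`, which reads `cos (θ - 2π/3) > cos (π - α)`.
  have hθ1' : -Real.pi + α < θ - 2 * Real.pi / 3 := by
    by_contra hc
    push Not at hc
    have hle : Real.cos (-(θ - 2 * Real.pi / 3)) ≤ Real.cos (Real.pi - α) :=
      Real.cos_le_cos_of_nonneg_of_le_pi (by linarith) (by linarith) (by linarith)
    rw [Real.cos_neg, Real.cos_pi_sub, hcosα] at hle
    have hD := capD_pos hu 1
    have he := (hrotθ 1).2
    have ht : trisect θ 1 = θ - 2 * Real.pi / 3 := rfl
    rw [ht] at he
    rw [← hs_def, he] at hD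
    have : s * (S / s * Real.cos (θ - 2 * Real.pi / 3) - 0 * Real.sin (θ - 2 * Real.pi / 3)) =
        S * Real.cos (θ - 2 * Real.pi / 3) := by field_simp; ring
    rw [this] at hD
    have h5 : S * Real.cos (θ - 2 * Real.pi / 3) ≤ S * -(1 / S) :=
      mul_le_mul_of_nonneg_left hle hSpos.le
    rw [mul_neg, mul_one_div_cancel hSpos.ne'] at h5
    linarith
  apply exists_bubble_of_angle hu hs (x := θ - α)
  · intro i
    fin_cases i
    · simp only [trisect, Fin.zero_eta, Matrix.cons_val_zero]
      constructor <;> linarith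
    · simp only [trisect, Fin.mk_one, Matrix.cons_val_one, Matrix.cons_val_zero]
      constructor <;> linarith
    · simp only [trisect, Fin.reduceFinMk, Matrix.cons_val]
      constructor <;> linarith
  · intro i
    rw [(hrot i).1]
    field_simp
  · have hD := capD_pos hu 2
    rw [← hs_def, (hrot 2).2] at hD
    have : s * (1 / s * Real.cos (trisect (θ - α) 2) - 1 * Real.sin (trisect (θ - α) 2)) =
      Real.cos (trisect (θ - α) 2) - s * Real.sin (trisect (θ - α) 2) := by field_simp
    rw [this] at hD
    linarith

/-! ### Round spheres -/

/-- The volume of a ball, as a function of `E = exp (2 r)`. -/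
noncomputable def ballVol (E : ℝ) : ℝ := Real.pi * ((E - 1 / E) / 2 - Real.log E)

lemma hypVolume_aboveSide {h κ : ℝ} (hh : 0 < h) (hκ : 0 < κ) :
    hypVolume (aboveSide h κ) = ENNReal.ofReal (ballVol (1 + 2 / (κ * h))) := by
  have hle : h ≤ h + 2 / κ := by
    have : 0 < 2 / κ := by positivity
    linarith
  have hpos : 0 < h + 2 / κ := hh.trans_le hle
  have hslice : ∀ t : ℝ, 0 < t → {ζ : ℂ | (ζ, t) ∈ aboveSide h κ} =
      {ζ : ℂ | ‖ζ‖ ^ 2 < discSq h κ t} := by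
    intro t ht
    ext ζ
    simp [aboveSide, ht, sideFun_neg_iff_of_pos hκ]
  -- A ball needs a single profile and no exceptional height: `ε = 0` kills the second profile, and
  -- `T = 0` excludes no positive height.
  rw [hypVolume_eq_of_slice (measurableSet_aboveSide h κ) (continuous_discSq h κ)
    (continuous_discSq h κ) hh hle hh hle (T := 0) (ε := 0)]
  · rw [zero_mul, add_zero]
    change ENNReal.ofReal (capVolume h κ (h + 2 / κ)) = _
    rw [capVolume_eq hh hpos, ballVol, show 1 + 2 / (κ * h) = (h + 2 / κ) / h by field_simp,
      show h / (h + 2 / κ) = ((h + 2 / κ) / h)⁻¹ by rw [inv_div], Real.log_inv, discSq]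
    congr 1
    generalize Real.log _ = l
    field_simp
    ring
  · intro t ht _
    rw [hslice t ht, volume_norm_sq_lt_max, zero_mul, add_zero]
    have : (Set.Ioo h (h + 2 / κ)).indicator (discSq h κ) t = max (discSq h κ t) 0 := by
      rw [discSq_eq_mul]
      by_cases h1 : h < t
      · by_cases h2 : t < h + 2 / κ
        · rw [Set.indicator_of_mem (show t ∈ Set.Ioo h (h + 2 / κ) from ⟨h1, h2⟩), discSq_eq_mul,
            max_eq_left (mul_nonneg (by linarith) (by linarith))]
        · rw [Set.indicator_of_notMem (fun hh => h2 hh.2),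
            max_eq_right (mul_nonpos_of_nonneg_of_nonpos (by linarith) (by linarith))]
      · rw [Set.indicator_of_notMem (fun hh => h1 hh.1),
          max_eq_right (mul_nonpos_of_nonpos_of_nonneg (by linarith) (by linarith))]
    rw [this]
    exact ⟨le_max_right _ _, rfl⟩

lemma capArea_sphere {h κ : ℝ} (hh : 0 < h) (hκ : 0 < κ) :
    capArea h κ (Real.pi / κ) =
      Real.pi * (1 + 2 / (κ * h) - 2 + 1 / (1 + 2 / (κ * h))) := by
  have hpi := Real.pi_pos
  have h1 := mul_profileRadius κ (Real.pi / κ)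
  have h2 := mul_profileHeight_sub h κ (Real.pi / κ)
  rw [mul_div_cancel₀ _ hκ.ne', Real.sin_pi] at h1
  rw [mul_div_cancel₀ _ hκ.ne', Real.cos_pi] at h2
  have h3 : profileRadius κ (Real.pi / κ) = 0 := (mul_eq_zero.1 h1).resolve_left hκ.ne'
  have h4 : profileHeight h κ (Real.pi / κ) = h + 2 / κ := by
    field_simp
    linarith
  have hpos : 0 < h + 2 / κ := by positivity
  rw [capArea_eq hh (by positivity) (by rw [abs_of_pos hκ, mul_div_cancel₀ _ hκ.ne'])
    (by rwa [h4]), h3, h4]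
  field_simp
  ring

lemma hasDerivAt_ballVol {E : ℝ} (hE : E ≠ 0) :
    HasDerivAt ballVol (Real.pi * ((1 - 1 / E) ^ 2 / 2)) E := by
  have h1 := (hasDerivAt_const E (1 : ℝ)).div (hasDerivAt_id E) hE
  refine (((((hasDerivAt_id E).sub h1).div_const 2).sub
    (Real.hasDerivAt_log hE)).const_mul Real.pi).congr_deriv ?_
  simp only [id]
  field_simp
  ring

lemma strictMonoOn_ballVol : StrictMonoOn ballVol (Set.Ici 1) := by
  apply strictMonoOn_of_deriv_pos (convex_Ici 1)
  · intro E hE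
    have : (1 : ℝ) ≤ E := hE
    exact (hasDerivAt_ballVol (by linarith)).continuousAt.continuousWithinAt
  · intro E hE
    rw [interior_Ici] at hE
    have hE1 : (1 : ℝ) < E := hE
    rw [(hasDerivAt_ballVol (by linarith)).deriv]
    have : 1 / E < 1 := (div_lt_one (by linarith)).2 hE1
    have : 0 < (1 - 1 / E) ^ 2 := pow_pos (by linarith) 2
    have := Real.pi_pos
    positivity

lemma ballVol_one : ballVol 1 = 0 := by simp [ballVol]

lemma ballVol_pos {E : ℝ} (hE : 1 < E) : 0 < ballVol E := by
  rw [← ballVol_one]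
  exact strictMonoOn_ballVol Set.self_mem_Ici (Set.mem_Ici.2 hE.le) hE

lemma exists_ballVol_eq {v : ℝ} (hv : 0 < v) : ∃ E, 1 < E ∧ ballVol E = v := by
  have hpi := Real.pi_pos
  -- With `log M ≤ M/4 + 1` the volume at `M` is at least `π (M/4 - 3/2)`, which exceeds `v` for
  -- this `M`.
  set M := 4 * (v / Real.pi + 2) with hM
  have hvp : 0 < v / Real.pi := by positivity
  have hM1 : 1 ≤ M := by linarith
  have hlarge : v ≤ ballVol M := by
    have h1 : Real.log M ≤ M / 4 + 1 := by
      have h2 := Real.log_le_sub_one_of_pos (show 0 < M / 4 by linarith)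
      have h3 := Real.log_le_sub_one_of_pos (show (0 : ℝ) < 2 by norm_num)
      rw [Real.log_div (by linarith) (by norm_num), show (4 : ℝ) = 2 ^ 2 by norm_num,
        Real.log_pow] at h2
      push_cast at h2
      linarith
    have h4 : 1 / M ≤ 1 := (div_le_one (by linarith)).2 hM1
    have h5 : v / Real.pi ≤ (M - 1 / M) / 2 - Real.log M := by linarith
    rw [ballVol]
    calc v = Real.pi * (v / Real.pi) := by field_simp
      _ ≤ _ := mul_le_mul_of_nonneg_left h5 hpi.le
  have hcont : ContinuousOn ballVol (Set.Icc 1 M) := fun E hE =>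
    (hasDerivAt_ballVol (by linarith [hE.1])).continuousAt.continuousWithinAt
  obtain ⟨E, hE, hEv⟩ := intermediate_value_Icc hM1 hcont
    (show v ∈ Set.Icc (ballVol 1) (ballVol M) from ⟨by rw [ballVol_one]; exact hv.le, hlarge⟩)
  refine ⟨E, lt_of_le_of_ne hE.1 ?_, hEv⟩
  rintro rfl
  rw [ballVol_one] at hEv
  exact hv.ne hEv

lemma sphereArea_ballVol {E : ℝ} (hE : 1 < E) :
    sphereArea (ballVol E) = Real.pi * (E - 2 + 1 / E) := by
  have hE0 : 0 < E - 1 := by linarith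
  have hex : ∃ a : ℝ, ∃ h κ : ℝ, 0 < h ∧ 0 < κ ∧
      hypVolume (aboveSide h κ) = ENNReal.ofReal (ballVol E) ∧ a = capArea h κ (Real.pi / κ) := by
    -- Lower pole `1` and upper pole `E`: the parameter of a ball is the ratio of its pole heights.
    refine ⟨_, 1, 2 / (E - 1), one_pos, by positivity, ?_, rfl⟩
    rw [hypVolume_aboveSide one_pos (by positivity)]
    congr 2
    field_simp
    ring
  obtain ⟨h, κ, hh, hκ, hvol, ha⟩ := Classical.epsilon_spec hex
  change sphereArea (ballVol E) = _ at ha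
  have hE' : 1 < 1 + 2 / (κ * h) := by
    have : 0 < 2 / (κ * h) := by positivity
    linarith
  rw [hypVolume_aboveSide hh hκ,
    ENNReal.ofReal_eq_ofReal_iff (ballVol_pos hE').le (ballVol_pos hE).le] at hvol
  have : 1 + 2 / (κ * h) = E := strictMonoOn_ballVol.injOn (Set.mem_Ici.2 hE'.le)
    (Set.mem_Ici.2 hE.le) hvol
  rw [ha, capArea_sphere hh hκ, this]

/-- Area and volume are both explicit in `E`, and the quotient of their derivatives is `2 coth r`; a
local inverse of `ballVol` makes `E` a differentiable function of the volume. -/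
lemma hasDerivAt_sphereArea {E : ℝ} (hE : 1 < E) :
    HasDerivAt sphereArea (2 * ((E + 1) / (E - 1))) (ballVol E) := by
  have hE0 : E ≠ 0 := by linarith
  have hc : ContDiffAt ℝ 1 ballVol E := by
    have h1 := (contDiffAt_const (c := (1 : ℝ)) (n := 1)).div (contDiffAt_id (𝕜 := ℝ) (x := E)) hE0
    exact contDiffAt_const.mul (((contDiffAt_id.sub h1).div_const 2).sub
      (Real.contDiffAt_log.2 hE0))
  have hs : HasStrictDerivAt ballVol (Real.pi * ((1 - 1 / E) ^ 2 / 2)) E :=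
    hc.hasStrictDerivAt' (hasDerivAt_ballVol hE0) one_ne_zero
  have hne : Real.pi * ((1 - 1 / E) ^ 2 / 2) ≠ 0 := by
    have : 1 / E < 1 := (div_lt_one (by linarith)).2 hE
    have : 0 < (1 - 1 / E) ^ 2 := pow_pos (by linarith) 2
    have := Real.pi_pos
    positivity
  set g := hs.localInverse ballVol _ E hne with hg
  have hgd : HasDerivAt g (Real.pi * ((1 - 1 / E) ^ 2 / 2))⁻¹ (ballVol E) :=
    (hs.to_localInverse hne).hasDerivAt
  have hF := hs.hasStrictFDerivAt_equiv hne
  have hgE : g (ballVol E) = E := hF.localInverse_apply_image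
  have hright : ∀ᶠ y in nhds (ballVol E), ballVol (g y) = y := hF.eventually_right_inverse
  have hA : HasDerivAt (fun E : ℝ => Real.pi * (E - 2 + 1 / E)) (Real.pi * (1 - 1 / E ^ 2))
      (g (ballVol E)) := by
    rw [hgE]
    have h1 := (hasDerivAt_const E (1 : ℝ)).div (hasDerivAt_id E) hE0
    refine ((((hasDerivAt_id E).sub_const 2).add h1).const_mul Real.pi).congr_deriv ?_
    simp only [id]
    ring
  have hcomp := hA.comp (ballVol E) hgd
  have hcomp' : HasDerivAt (fun y => Real.pi * (g y - 2 + 1 / g y)) (2 * ((E + 1) / (E - 1)))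
      (ballVol E) := by
    refine hcomp.congr_deriv ?_
    have : E - 1 ≠ 0 := by linarith
    have := Real.pi_pos.ne'
    field_simp
    ring
  apply hcomp'.congr_of_eventuallyEq
  have hmem : ∀ᶠ y in nhds (ballVol E), g y ∈ Set.Ioi 1 := by
    apply hgd.continuousAt.eventually_mem
    rw [hgE]
    exact Ioi_mem_nhds hE
  filter_upwards [hmem, hright] with y hy1 hy2
  rw [← sphereArea_ballVol hy1, hy2]

/-! ### Comparison of a double bubble with a ball -/

lemma belowSide_eq_aboveSide {h κ : ℝ} (hκ : κ ≠ 0) :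
    belowSide h κ = aboveSide (h + 2 / κ) (-κ) := by
  ext p
  have : sideFun (h + 2 / κ) (-κ) p = -sideFun h κ p := by
    unfold sideFun; field_simp; ring
  simp [belowSide, aboveSide, this]

lemma hypVolume_horizontal (T : ℝ) : hypVolume {p | p.2 = T} = 0 := by
  apply setLIntegral_measure_zero
  apply measure_mono_null Set.inter_subset_left
  have : {p : ℂ × ℝ | p.2 = T} = Set.univ ×ˢ {T} := by ext; simp
  rw [this, Measure.volume_eq_prod, Measure.prod_prod]
  simp

/-- The upper region lies in the ball that carries the upper outer cap, up to a null set. The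
parameter of that ball is found by solving `u.1 = coth r` for `E = exp (2r)`. -/
lemma bubbleVol_fst_le {u : ℝ × ℝ} (hu : u ∈ quadrant) :
    (bubbleVol u).1 ≤ ballVol (1 + 2 / (u.1 - 1)) := by
  have h1 : 1 < u.1 := hu.1
  obtain ⟨B, rfl⟩ := exists_bubble_of_mem_quadrant hu
  have hκ := B.upper_neg
  have hE : 1 < 1 + 2 / (B.curv.1 - 1) := by
    have : 0 < 2 / (B.curv.1 - 1) := div_pos two_pos (by linarith)
    linarith
  have hle : hypVolume B.upperRegion ≤ hypVolume (belowSide (B.h 1) (B.κ 1)) := by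
    calc hypVolume B.upperRegion
        ≤ hypVolume (belowSide (B.h 1) (B.κ 1) ∪ {p | p.2 = B.circleHeight}) :=
          lintegral_mono_set (Set.inter_subset_inter_left _ B.upperRegion_subset)
      _ ≤ hypVolume (belowSide (B.h 1) (B.κ 1)) + hypVolume {p | p.2 = B.circleHeight} := by
          unfold hypVolume
          rw [Set.union_inter_distrib_right]
          exact lintegral_union_le _ _ _
      _ = _ := by rw [hypVolume_horizontal, add_zero]
  rw [belowSide_eq_aboveSide hκ.ne, hypVolume_aboveSide B.upper_sphere.2 (neg_pos.2 hκ),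
    B.hypVolume_upperRegion_eq, show -B.κ 1 * (B.h 1 + 2 / B.κ 1) = B.curv.1 - 1 by
      simp only [StandardDoubleBubble.curv]
      have := hκ.ne
      field_simp
      ring] at hle
  exact (ENNReal.ofReal_le_ofReal_iff (ballVol_pos hE).le).1 hle

/-- The area of a double bubble depends only on its volumes. -/
lemma doubleBubbleArea_eq {u : ℝ × ℝ} (hu : u ∈ quadrant) {v w : ℝ} (hv : 0 < v) (hw : 0 < w)
    (h : bubbleVol u = (v, w)) : doubleBubbleArea v w = bubbleArea u := by
  have hex : ∃ a : ℝ, ∃ B : StandardDoubleBubble,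
      hypVolume B.upperRegion = ENNReal.ofReal v ∧
      hypVolume B.lowerRegion = ENNReal.ofReal w ∧ a = B.area := by
    obtain ⟨B, hB⟩ := exists_bubble_of_mem_quadrant hu
    refine ⟨_, B, ?_, ?_, rfl⟩
    · rw [B.hypVolume_upperRegion_eq, hB, h]
    · rw [B.hypVolume_lowerRegion_eq, hB, h]
  obtain ⟨B, h1, h2, h3⟩ := Classical.epsilon_spec hex
  change doubleBubbleArea v w = _ at h3
  -- `ENNReal.ofReal` does not separate nonpositive numbers, so positivity of the prescribed volume
  -- is transferred first.
  have key : ∀ {x y : ℝ}, 0 < y → ENNReal.ofReal x = ENNReal.ofReal y → x = y := by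
    intro x y hy hxy
    have hx : 0 < x := by
      rw [← ENNReal.ofReal_pos, hxy, ENNReal.ofReal_pos]; exact hy
    exact (ENNReal.ofReal_eq_ofReal_iff hx.le hy.le).1 hxy
  rw [B.hypVolume_upperRegion_eq] at h1
  rw [B.hypVolume_lowerRegion_eq] at h2
  have hc : bubbleVol B.curv = bubbleVol u := by
    rw [h]
    exact Prod.ext (key hv h1) (key hw h2)
  rw [h3, B.area_eq, injOn_bubbleVol B.curv_mem_quadrant hu hc]

/-! ### The numerical inequality -/

/-- Isolates the linear growth of `E - 1` in the volume, with `2 log E` as the correction to be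
estimated. -/
lemma sub_one_eq_of_ballVol {E : ℝ} (hE : E ≠ 0) :
    E - 1 = 2 * ballVol E / Real.pi - 1 + 1 / E + 2 * Real.log E := by
  unfold ballVol
  field_simp
  ring

lemma fiftyfour_lt_exp_four : 54 < Real.exp 4 := by
  have h := Real.exp_one_gt_d9
  have : Real.exp 4 = Real.exp 1 ^ 4 := by rw [← Real.exp_nat_mul]; norm_num
  rw [this]
  calc (54 : ℝ) < 2.718 ^ 4 := by norm_num
    _ ≤ _ := pow_le_pow_left₀ (by norm_num) (by linarith) 4

lemma exp_four_lt : Real.exp 4 < 55 := by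
  have h := Real.exp_one_lt_d9
  have : Real.exp 4 = Real.exp 1 ^ 4 := by rw [← Real.exp_nat_mul]; norm_num
  rw [this]
  calc Real.exp 1 ^ 4 ≤ 2.7183 ^ 4 := pow_le_pow_left₀ (by positivity) (by linarith) 4
    _ < 55 := by norm_num

lemma lt_exp_five : 148 < Real.exp 5 := by
  have h := Real.exp_one_gt_d9
  have : Real.exp 5 = Real.exp 1 ^ 5 := by rw [← Real.exp_nat_mul]; norm_num
  rw [this]
  calc (148 : ℝ) < 2.718 ^ 5 := by norm_num
    _ ≤ _ := pow_le_pow_left₀ (by norm_num) (by linarith) 5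

/-- The tangent line of the logarithm at `exp x`, with its slope weakened to a rational number. -/
lemma log_le_of_lt_exp {a x y : ℝ} (ha : 0 < a) (hax : a < Real.exp x) (hy : 0 < y) :
    Real.log y ≤ x - 1 + y / a := by
  have h1 := Real.log_le_sub_one_of_pos (show 0 < y / Real.exp x by positivity)
  rw [Real.log_div hy.ne' (Real.exp_pos x).ne', Real.log_exp] at h1
  have : y / Real.exp x ≤ y / a := div_le_div_of_nonneg_left hy.le ha hax.le
  linarith

lemma curvature_inequality {v w A B C : ℝ} (hv : 127 ≤ v) (hw : 0 < w) (hvw : 0.847 * w ≤ v)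
    (hA : 1 < A) (hB : 1 < B) (hC : 1 < C) (hAv : ballVol A = v / 2) (hBv : v ≤ ballVol B)
    (hCv : ballVol C = v + w) :
    2 * ((B + 1) / (B - 1)) < (A + 1) / (A - 1) + (C + 1) / (C - 1) := by
  have hpi := Real.pi_pos
  have hpi' := Real.pi_lt_d2
  have eA := sub_one_eq_of_ballVol (E := A) (by linarith)
  have eB := sub_one_eq_of_ballVol (E := B) (by linarith)
  have eC := sub_one_eq_of_ballVol (E := C) (by linarith)
  set P := 2 * v / Real.pi with hP
  have hP80 : 80 ≤ P := by
    rw [hP, le_div_iff₀ hpi]; linarith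
  have hPA : 2 * ballVol A / Real.pi = P / 2 := by rw [hAv, hP]; ring
  have hPB : P ≤ 2 * ballVol B / Real.pi := by
    rw [hP]; apply div_le_div_of_nonneg_right _ hpi.le; linarith
  have hPC1 : P ≤ 2 * ballVol C / Real.pi := by
    rw [hP, hCv]; apply div_le_div_of_nonneg_right _ hpi.le; linarith
  have hPC : 2 * ballVol C / Real.pi ≤ 2.181 * P := by
    rw [hP, hCv, mul_div_assoc', div_le_div_iff_of_pos_right hpi]; linarith
  have iA : 0 < 1 / A := by positivity
  have iB : 0 < 1 / B := by positivity
  have iC : 0 < 1 / C := by positivity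
  have lA0 := Real.log_pos hA
  have lB0 := Real.log_pos hB
  have lC0 := Real.log_pos hC
  -- Dropping the logarithm, `B - 1 ≥ P - 1 ≥ 79`, so `B > 55 > exp 4`. Feeding `2 log B ≥ 8` back
  -- gives the bound `P + 7`.
  have lB : 4 ≤ Real.log B := by
    rw [Real.le_log_iff_exp_le (by linarith)]
    linarith [exp_four_lt]
  -- Upper bounds for `A` and `C` use tangents at `exp 4` and `exp 5`; absorbing the terms `A/27`
  -- and `C/74` yields the decimals in `bA` and `bC`.
  have lA := log_le_of_lt_exp (by norm_num) fiftyfour_lt_exp_four (zero_lt_one.trans hA)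
  have lC := log_le_of_lt_exp (by norm_num) lt_exp_five (zero_lt_one.trans hC)
  have iA' : 1 / A ≤ 1 / 39 := one_div_le_one_div_of_le (by norm_num) (by linarith)
  have iC' : 1 / C ≤ 1 / 39 := one_div_le_one_div_of_le (by norm_num) (by linarith)
  have bB : P + 7 ≤ B - 1 := by linarith
  have bA : A - 1 ≤ 0.52 * P + 5.3 := by linarith
  have bC : C - 1 ≤ 2.212 * P + 7.2 := by linarith
  have a0 : 0 < A - 1 := by linarith
  have b0 : 0 < B - 1 := by linarith
  have c0 : 0 < C - 1 := by linarith
  have rA : (0.52 * P + 5.3)⁻¹ ≤ (A - 1)⁻¹ := inv_anti₀ a0 bA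
  have rB : (B - 1)⁻¹ ≤ (P + 7)⁻¹ := inv_anti₀ (by linarith) bB
  have rC : (2.212 * P + 7.2)⁻¹ ≤ (C - 1)⁻¹ := inv_anti₀ c0 bC
  -- The leading coefficients leave room, since `1/0.52 + 1/2.212 > 2`; `P ≥ 80` controls the
  -- remaining terms.
  have key : 2 * (P + 7)⁻¹ < (0.52 * P + 5.3)⁻¹ + (2.212 * P + 7.2)⁻¹ := by
    rw [inv_add_inv (by positivity) (by positivity), ← div_eq_mul_inv,
      div_lt_div_iff₀ (by linarith) (by positivity)]
    nlinarith
  have hsplit : ∀ {E : ℝ}, 0 < E - 1 → (E + 1) / (E - 1) = 1 + 2 * (E - 1)⁻¹ := by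
    intro E hE
    field_simp
    ring
  rw [hsplit a0, hsplit b0, hsplit c0]
  linarith

end HypBubble

/-! ### Derivative of the Hutchings function -/

theorem lemma4p26 (v w : ℝ) (hw : 150 ≤ w) (hv : (Real.exp 1 ^ 2 / 4 - 1) * w ≤ v) :
    DifferentiableAt ℝ (fun x : ℝ => HypBubble.hutchings x w) v ∧
      0 < deriv (fun x : ℝ => HypBubble.hutchings x w) v := by
  have he : 0.847 ≤ Real.exp 1 ^ 2 / 4 - 1 := by
    nlinarith [Real.exp_one_gt_d9]
  have hw0 : 0 < w := by linarith
  have hvw : 0.847 * w ≤ v := (mul_le_mul_of_nonneg_right he hw0.le).trans hv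
  -- `0.847 * 150 = 127.05`.
  have hv127 : 127 ≤ v := by linarith
  have hv0 : 0 < v := by linarith
  obtain ⟨A, hA, hAv⟩ := HypBubble.exists_ballVol_eq (show 0 < v / 2 by linarith)
  obtain ⟨C, hC, hCv⟩ := HypBubble.exists_ballVol_eq (show 0 < v + w by linarith)
  obtain ⟨u, hu, huv⟩ := HypBubble.exists_bubbleVol_eq hv0 hw0
  have hu1 : 1 < u.1 := hu.1
  have hB : 1 < 1 + 2 / (u.1 - 1) := by
    have : 0 < 2 / (u.1 - 1) := div_pos two_pos (by linarith)
    linarith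
  have hBv : v ≤ HypBubble.ballVol (1 + 2 / (u.1 - 1)) := by
    have := HypBubble.bubbleVol_fst_le hu
    rwa [huv] at this
  have dA : HasDerivAt (fun x => HypBubble.sphereArea (x / 2))
      (2 * ((A + 1) / (A - 1)) * (1 / 2)) v := by
    have h1 := HypBubble.hasDerivAt_sphereArea hA
    rw [hAv] at h1
    exact h1.comp v ((hasDerivAt_id v).div_const 2)
  have dC : HasDerivAt (fun x => HypBubble.sphereArea (x + w)) (2 * ((C + 1) / (C - 1))) v := by
    have h1 := HypBubble.hasDerivAt_sphereArea hC
    rw [hCv] at h1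
    exact h1.comp_add_const v w
  have dB : HasDerivAt (fun x => HypBubble.doubleBubbleArea x w) (2 * u.1) v := by
    refine HypBubble.hasDerivAt_of_eq_bubbleArea ?_ hu huv
    filter_upwards [Ioi_mem_nhds hv0] with x hx u' hu' hu'x
    exact HypBubble.doubleBubbleArea_eq hu' hx hw0 hu'x
  have hF : HasDerivAt (fun x => HypBubble.hutchings x w)
      (2 * (2 * ((A + 1) / (A - 1)) * (1 / 2)) + 2 * ((C + 1) / (C - 1)) - 2 * (2 * u.1)) v :=
    (((dA.const_mul 2).add_const (HypBubble.sphereArea w)).add dC).sub (dB.const_mul 2)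
  refine ⟨hF.differentiableAt, ?_⟩
  rw [hF.deriv]
  have hlt := HypBubble.curvature_inequality hv127 hw0 hvw hA hB hC hAv hBv hCv
  have hu1' : (1 + 2 / (u.1 - 1) + 1) / (1 + 2 / (u.1 - 1) - 1) = u.1 := by
    have : u.1 - 1 ≠ 0 := by linarith
    field_simp
    ring
  rw [hu1'] at hlt
  linarith
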